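/- Let $\{u,v\}$ be a basis of $\mathbb{R}^2$, let $\Lambda=\mathbb{Z}u+\mathbb{Z}v$, let $d(\Lambda)$ be the area of the parallelogram spanned by $u$ and $v$, and let $\pi:\mathbb{R}^2\to\mathbb{T}^2=\mathbb{R}^2/\Lambda$ be the quotient map. Put $m_x(\Lambda)=d_x+\frac{d(\Lambda)}{d_x}$ if $(a,0)\in\Lambda$ for some $a\ne0$, where $d_x$ is the least positive number with $(d_x,0)\in\Lambda$, and $m_x(\Lambda)=\infty$ otherwise. Define $m_y(\Lambda)$ in the same way with the lattice points $(0,b)$ in place of $(a,0)$. An axis-aligned rectangular tiling $T$ of $\mathbb{T}^2$ consists of finitely many rectangles $R_i=[a_i,b_i]\times[c_i,d_i]\subseteq\mathbb{R}^2$ with $a_i<b_i$ and $c_i<d_i$ ($i=1,\dots,k$) such that $\pi$ is injective on the interior of each $R_i$, the images under $\pi$ of the interiors of the $R_i$ are pairwise disjoint, and $\mathbb{T}^2=\bigcup_i\pi(R_i)$. The skeleton $G(T)$ is the multigraph on $\mathbb{T}^2$ whose vertices are the images of the corners of all rectangles and whose edges are the arcs into which the vertices subdivide the images of the sides of all rectangles.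 The length $m(T)$ is the sum of the lengths of all edges of $G(T)$. A horizontal path is a path in $G(T)$ (no repeated vertices, at least one edge) all of whose edges are horizontal. It is a maximal horizontal path if it is not a sub-path of another horizontal path. Paths are not distinguished from their reversals. Maximal vertical paths are defined analogously. Lemma 4.3. If $T$ is an axis-aligned rectangular tiling of $\mathbb{T}^2$ with $m(T)<\min\{m_x(\Lambda),m_y(\Lambda)\}$, then there is an axis-aligned rectangular tiling $T'$ of $\mathbb{T}^2$ with $m(T')\le m(T)$ whose skeleton $G(T')$ has exactly one maximal horizontal path and exactly one maximal vertical path. ($T'=T$ is allowed.) -/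

import Mathlib

noncomputable section

namespace FlatTorus

/-- The lattice `ℤ u + ℤ v` in the plane. -/
def latticeOf (u v : ℝ × ℝ) : AddSubgroup (ℝ × ℝ) := AddSubgroup.closure {u, v}

/-- The covolume of `ℤ u + ℤ v`: the area of the parallelogram spanned by `u` and `v`. -/
def covol (u v : ℝ × ℝ) : ℝ := |u.1 * v.2 - u.2 * v.1|

/-- The two coordinate directions. -/
inductive Axis
  | hor
  | ver

/-- The unit vector pointing right, respectively up. -/
def Axis.vec : Axis → ℝ × ℝ
  | .hor => (1, 0)
  | .ver => (0, 1)

/-- The least positive `t` such that `t` times the unit vector of the axis lies in `Λ`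
(used only if such a `t` exists; for a lattice the infimum is then attained). -/
def minPeriod (Λ : AddSubgroup (ℝ × ℝ)) (ax : Axis) : ℝ :=
  sInf {t : ℝ | 0 < t ∧ t • ax.vec ∈ Λ}

open Classical in
/-- The quantity `m_x(Λ)` (for `ax = hor`) or `m_y(Λ)` (for `ax = ver`) of `Λ = ℤ u + ℤ v`. -/
def mAxis (u v : ℝ × ℝ) (ax : Axis) : EReal :=
  if ∃ t : ℝ, t ≠ 0 ∧ t • ax.vec ∈ latticeOf u v then
    ((minPeriod (latticeOf u v) ax + covol u v / minPeriod (latticeOf u v) ax : ℝ) : EReal)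
  else ⊤

/-- The torus `ℝ² / Λ`. -/
abbrev Torus (Λ : AddSubgroup (ℝ × ℝ)) : Type := (ℝ × ℝ) ⧸ Λ

/-- The quotient map `ℝ² → ℝ² / Λ`. -/
def proj (Λ : AddSubgroup (ℝ × ℝ)) : ℝ × ℝ → Torus Λ := fun x => (x : (ℝ × ℝ) ⧸ Λ)

/-- An axis-aligned rectangle `[a, b] × [c, d]` in the plane, with nonempty interior. -/
structure Rect where
  a : ℝ
  b : ℝ
  c : ℝ
  d : ℝ
  a_lt_b : a < b
  c_lt_d : c < d

namespace Rect

def toSet (R : Rect) : Set (ℝ × ℝ) := Set.Icc R.a R.b ×ˢ Set.Icc R.c R.d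

def inner (R : Rect) : Set (ℝ × ℝ) := Set.Ioo R.a R.b ×ˢ Set.Ioo R.c R.d

def corners (R : Rect) : Set (ℝ × ℝ) := {(R.a, R.c), (R.b, R.c), (R.a, R.d), (R.b, R.d)}

/-- The left endpoints of the two horizontal sides, respectively the lower endpoints of the two
vertical sides. -/
def sideStarts (R : Rect) : Axis → Set (ℝ × ℝ)
  | .hor => {(R.a, R.c), (R.a, R.d)}
  | .ver => {(R.a, R.c), (R.b, R.c)}

/-- The length of the horizontal (respectively vertical) sides. -/
def extent (R : Rect) : Axis → ℝ
  | .hor => R.b - R.a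
  | .ver => R.d - R.c

end Rect

/-- An axis-aligned rectangular tiling of the torus `ℝ² / Λ`. -/
structure Tiling (Λ : AddSubgroup (ℝ × ℝ)) where
  k : ℕ
  rect : Fin k → Rect
  injOn_inner : ∀ i, Set.InjOn (proj Λ) (rect i).inner
  disjoint_inner : ∀ i j, i ≠ j → Disjoint (proj Λ '' (rect i).inner) (proj Λ '' (rect j).inner)
  cover : ⋃ i, proj Λ '' (rect i).toSet = Set.univ

/-- An axis-parallel arc on the torus: it runs from `start` to the right (if `axis = hor`) or
upwards (if `axis = ver`) over the distance `len`. -/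
structure Arc (Λ : AddSubgroup (ℝ × ℝ)) where
  axis : Axis
  start : Torus Λ
  len : ℝ

/-- The end of an arc. -/
def Arc.finish {Λ : AddSubgroup (ℝ × ℝ)} (e : Arc Λ) : Torus Λ :=
  e.start + proj Λ (e.len • e.axis.vec)

namespace Tiling

variable {Λ : AddSubgroup (ℝ × ℝ)}

/-- The images of the corners of all rectangles. -/
def vertices (T : Tiling Λ) : Set (Torus Λ) := ⋃ i, proj Λ '' (T.rect i).corners

/-- The edges of the skeleton: the arcs into which the images of the sides of all rectangles are
subdivided by the vertices. Here `q` is the left (lower) endpoint of a side, and the arc is the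
image of the part of this side between the distances `s` and `t` from `q`. An edge that lies on
several sides is one and the same arc. -/
def edges (T : Tiling Λ) : Set (Arc Λ) :=
  {e | ∃ i, ∃ q ∈ (T.rect i).sideStarts e.axis, ∃ s t : ℝ,
    0 ≤ s ∧ s < t ∧ t ≤ (T.rect i).extent e.axis ∧
    e.start = proj Λ (q + s • e.axis.vec) ∧ e.len = t - s ∧
    proj Λ (q + s • e.axis.vec) ∈ T.vertices ∧ proj Λ (q + t • e.axis.vec) ∈ T.vertices ∧
    ∀ r ∈ Set.Ioo s t, proj Λ (q + r • e.axis.vec) ∉ T.vertices}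

theorem start_mem_vertices (T : Tiling Λ) {e : Arc Λ} (he : e ∈ T.edges) :
    e.start ∈ T.vertices := by
  obtain ⟨i, q, hq, s, t, h0, hst, hle, hs, hl, h1, h2, h3⟩ := he
  rwa [hs]

theorem finish_mem_vertices (T : Tiling Λ) {e : Arc Λ} (he : e ∈ T.edges) :
    e.finish ∈ T.vertices := by
  obtain ⟨i, q, hq, s, t, h0, hst, hle, hs, hl, h1, h2, h3⟩ := he
  have h : e.finish = proj Λ (q + t • e.axis.vec) := by
    unfold Arc.finish
    rw [hs, hl]
    show ((q + s • e.axis.vec + (t - s) • e.axis.vec : ℝ × ℝ) : Torus Λ) = _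
    rw [add_assoc, ← add_smul, add_sub_cancel]
    rfl
  rwa [h]

/-- The skeleton `G(T)` of a tiling, a multigraph drawn on the torus (loops and parallel edges may
occur). -/
def skeleton (T : Tiling Λ) : Graph (Torus Λ) (Arc Λ) where
  vertexSet := T.vertices
  edgeSet := T.edges
  IsLink e x y := e ∈ T.edges ∧ (x = e.start ∧ y = e.finish ∨ x = e.finish ∧ y = e.start)
  isLink_symm e _ := ⟨fun x y h => ⟨h.1, h.2.symm.imp And.symm And.symm⟩⟩
  eq_or_eq_of_isLink_of_isLink := by
    rintro e x y v w ⟨-, ⟨rfl, rfl⟩ | ⟨rfl, rfl⟩⟩ ⟨-, ⟨rfl, rfl⟩ | ⟨rfl, rfl⟩⟩ <;> simp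
  edge_mem_iff_exists_isLink e :=
    ⟨fun h => ⟨e.start, e.finish, h, Or.inl ⟨rfl, rfl⟩⟩, fun ⟨_, _, h, _⟩ => h⟩
  left_mem_of_isLink := by
    rintro e x y ⟨he, ⟨rfl, rfl⟩ | ⟨rfl, rfl⟩⟩
    · exact T.start_mem_vertices he
    · exact T.finish_mem_vertices he

/-- The length `m(T)`: the sum of the lengths of all edges of the skeleton (a finite set). -/
def length (T : Tiling Λ) : ℝ := ∑ᶠ e ∈ T.skeleton.edgeSet, e.len

/-- The sequence of vertices visited by a sequence of consecutive arcs. -/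
def vertexSeq : List (Arc Λ) → List (Torus Λ)
  | [] => []
  | e :: l => e.start :: (e :: l).map Arc.finish

/-- `P` is the sequence of edges of a horizontal (vertical) path of the skeleton: it has at least
one edge, all its edges are horizontal (vertical), each of them starts where the previous one ends,
and no vertex is repeated. Every such path of an undirected graph is traversed here from left to
right (upwards), so that each path is counted once and not once per orientation. -/
structure IsAxisPath (T : Tiling Λ) (ax : Axis) (P : List (Arc Λ)) : Prop where
  ne_nil : P ≠ []
  mem_edges : ∀ e ∈ P, e ∈ T.skeleton.edgeSet
  axis_eq : ∀ e ∈ P, e.axis = ax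
  chain : P.IsChain (fun e f => e.finish = f.start)
  nodup : (vertexSeq P).Nodup

/-- `P` is a maximal horizontal (vertical) path: it is not a sub-path of any other horizontal
(vertical) path. -/
def IsMaximalAxisPath (T : Tiling Λ) (ax : Axis) (P : List (Arc Λ)) : Prop :=
  T.IsAxisPath ax P ∧ ∀ Q, T.IsAxisPath ax Q → P <:+: Q → Q = P

end Tiling

end FlatTorus

end

/-!
In the plane, the half-open versions `[a, b) × [c, d)` of the tiles and of all their lattice
translates form a partition, and conversely every periodic partition of this kind is a tiling
(`Tiling.mem_unique`, `Tiling.exists_mem`, `Tiling.ofHalfOpen`). Every edge of the skeleton lies on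
exactly one lower or left side of a tile, so that `m(T)` is half of the total perimeter of the tiles
(`Tiling.length_eq_halfPerimeter`).

Among the tilings that are not longer than `T`, one with the least number of tiles is chosen; call
it `T'`. Suppose that the horizontal sides of its tiles are displaced vertically, in such a way that
overlapping sides (the upper side of one tile and the lower side of another one, with an interval
in common) move by the same amount. On every vertical line, the tiles stay stacked on each other
without gaps (`Stack.deform`), and so the result is a tiling as long as no height becomes negative,
where tiles of height zero are dropped. The length is linear in the displacement. Hence if some
height changes at all, then moving in the direction that does not increase the length until the
first tiles collapse gives a tiling with fewer tiles, which is impossible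
(`Tiling.Reduced.eq_of_compatible`).

The hypothesis on `m(T)` implies that the closed circles of the torus in the direction of an axis
are longer than what the sides in this direction can cover (`short_of_lt_mAxis`, from an area estimate, and
`Tiling.Short.le_sum_of_onSide`). If a displacement moves every tile as a whole, but not all by the
same amount, then there is a vertical line that consists of sides only, which is excluded
(`Tiling.Short.const_of_compatible`). Therefore all horizontal sides are related to each other by
chains of overlaps. They all lie on one segment, which does not close up, and the edges on this
segment form the only maximal horizontal path (`Tiling.exists_segment`,
`Tiling.existsUnique_isMaximalAxisPath`). The same applies to the vertical direction.

All lemmas are stated for an arbitrary `ax : Axis`, the direction of the sides in question. Of the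
two sides of a tile in this direction, the near side is the lower or left one, and the far side is
the upper or right one.
-/

noncomputable section

namespace FlatTorus

open Set Filter Topology MeasureTheory

variable {Λ : AddSubgroup (ℝ × ℝ)}

/-! ### Coordinates along and across an axis -/

namespace Axis

/-- The other coordinate direction. -/
def flip : Axis → Axis
  | hor => ver
  | ver => hor

@[simp] theorem flip_flip (ax : Axis) : ax.flip.flip = ax := by cases ax <;> rfl

theorem eq_or_eq_flip (ax bx : Axis) : bx = ax ∨ bx = ax.flip := by
  cases ax <;> cases bx <;> simp [flip]

/-- The coordinate of a point along the axis. -/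
def crd : Axis → ℝ × ℝ → ℝ
  | hor, p => p.1
  | ver, p => p.2

@[simp] theorem crd_add (ax : Axis) (p q : ℝ × ℝ) : ax.crd (p + q) = ax.crd p + ax.crd q := by
  cases ax <;> rfl

@[simp] theorem crd_sub (ax : Axis) (p q : ℝ × ℝ) : ax.crd (p - q) = ax.crd p - ax.crd q := by
  cases ax <;> rfl

@[simp] theorem crd_zero (ax : Axis) : ax.crd 0 = 0 := by
  cases ax <;> rfl

@[simp] theorem crd_vec (ax : Axis) (t : ℝ) : ax.crd (t • ax.vec) = t := by
  cases ax <;> simp [crd, vec]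

@[simp] theorem crd_flip_vec (ax : Axis) (t : ℝ) : ax.flip.crd (t • ax.vec) = 0 := by
  cases ax <;> simp [crd, vec, flip]

@[simp] theorem crd_vec_flip (ax : Axis) (t : ℝ) : ax.crd (t • ax.flip.vec) = 0 := by
  cases ax <;> simp [crd, vec, flip]

theorem ext_crd {p q : ℝ × ℝ} (ax : Axis) (h : ax.crd p = ax.crd q)
    (h' : ax.flip.crd p = ax.flip.crd q) : p = q := by
  cases ax <;> simp only [crd, flip] at h h' <;> ext <;> assumption

theorem eq_smul_vec {ax : Axis} {p : ℝ × ℝ} (h : ax.flip.crd p = 0) : p = ax.crd p • ax.vec :=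
  ext_crd ax (by simp) (by simp [h])

end Axis

namespace Rect

/-- The smaller coordinate bound of a rectangle in the direction of the axis. -/
def lo (R : Rect) : Axis → ℝ
  | .hor => R.a
  | .ver => R.c

/-- The larger coordinate bound of a rectangle in the direction of the axis. -/
def hi (R : Rect) : Axis → ℝ
  | .hor => R.b
  | .ver => R.d

theorem lo_lt_hi (R : Rect) (ax : Axis) : R.lo ax < R.hi ax := by
  cases ax
  exacts [R.a_lt_b, R.c_lt_d]

theorem extent_eq (R : Rect) (ax : Axis) : R.extent ax = R.hi ax - R.lo ax := by
  cases ax <;> rfl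

theorem extent_pos (R : Rect) (ax : Axis) : 0 < R.extent ax := by
  rw [extent_eq]; linarith [R.lo_lt_hi ax]

/-- The half-open rectangle `[a, b) × [c, d)`. -/
def halfOpen (R : Rect) : Set (ℝ × ℝ) := {p | ∀ ax : Axis, R.lo ax ≤ ax.crd p ∧ ax.crd p < R.hi ax}

theorem mem_toSet {R : Rect} {p : ℝ × ℝ} :
    p ∈ R.toSet ↔ ∀ ax : Axis, R.lo ax ≤ ax.crd p ∧ ax.crd p ≤ R.hi ax := by
  constructor
  · rintro ⟨h1, h2⟩ ax
    cases ax
    exacts [h1, h2]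
  · intro h
    exact ⟨h .hor, h .ver⟩

theorem mem_inner {R : Rect} {p : ℝ × ℝ} :
    p ∈ R.inner ↔ ∀ ax : Axis, R.lo ax < ax.crd p ∧ ax.crd p < R.hi ax := by
  constructor
  · rintro ⟨h1, h2⟩ ax
    cases ax
    exacts [h1, h2]
  · intro h
    exact ⟨h .hor, h .ver⟩

theorem inner_subset_halfOpen (R : Rect) : R.inner ⊆ R.halfOpen := fun _ hp ax =>
  ⟨(mem_inner.1 hp ax).1.le, (mem_inner.1 hp ax).2⟩

theorem halfOpen_subset_toSet (R : Rect) : R.halfOpen ⊆ R.toSet := fun _ hp =>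
  mem_toSet.2 fun ax => ⟨(hp ax).1, (hp ax).2.le⟩

theorem mem_halfOpen_iff {R : Rect} {p : ℝ × ℝ} (ax : Axis) :
    p ∈ R.halfOpen ↔ (R.lo ax ≤ ax.crd p ∧ ax.crd p < R.hi ax) ∧
      (R.lo ax.flip ≤ ax.flip.crd p ∧ ax.flip.crd p < R.hi ax.flip) := by
  refine ⟨fun h => ⟨h _, h _⟩, fun h bx => ?_⟩
  rcases ax.eq_or_eq_flip bx with rfl | rfl
  exacts [h.1, h.2]

theorem mem_corners {R : Rect} {p : ℝ × ℝ} (ax : Axis) :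
    p ∈ R.corners ↔ (ax.crd p = R.lo ax ∨ ax.crd p = R.hi ax) ∧
      (ax.flip.crd p = R.lo ax.flip ∨ ax.flip.crd p = R.hi ax.flip) := by
  obtain ⟨x, y⟩ := p
  cases ax <;> simp only [corners, Axis.crd, lo, hi, Axis.flip, mem_insert_iff,
    mem_singleton_iff, Prod.mk.injEq] <;> tauto

theorem mem_sideStarts {R : Rect} {p : ℝ × ℝ} (ax : Axis) :
    p ∈ R.sideStarts ax ↔ ax.crd p = R.lo ax ∧
      (ax.flip.crd p = R.lo ax.flip ∨ ax.flip.crd p = R.hi ax.flip) := by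
  obtain ⟨x, y⟩ := p
  cases ax <;> simp only [sideStarts, Axis.crd, lo, hi, Axis.flip, mem_insert_iff,
    mem_singleton_iff, Prod.mk.injEq] <;> tauto

/-- The lower left corner of a rectangle. -/
def origin (R : Rect) : ℝ × ℝ := (R.a, R.c)

@[simp] theorem crd_origin (R : Rect) (ax : Axis) : ax.crd R.origin = R.lo ax := by
  cases ax <;> rfl

theorem origin_add_mem_halfOpen (R : Rect) (ax : Axis) {s : ℝ} (h0 : 0 ≤ s)
    (hs : s < R.extent ax) : R.origin + s • ax.vec ∈ R.halfOpen := by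
  rw [extent_eq] at hs
  rw [mem_halfOpen_iff ax]
  simp only [Axis.crd_add, crd_origin, Axis.crd_vec, Axis.crd_flip_vec, add_zero]
  exact ⟨⟨by linarith, by linarith⟩, le_rfl, R.lo_lt_hi _⟩

/-- The rectangle with the given coordinate bounds along `ax` and across it. -/
def ofBounds (ax : Axis) (s t s' t' : ℝ) (h : s < t) (h' : s' < t') : Rect :=
  match ax with
  | .hor => ⟨s, t, s', t', h, h'⟩
  | .ver => ⟨s', t', s, t, h', h⟩

section

variable (ax : Axis) (s t s' t' : ℝ) (h : s < t) (h' : s' < t')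

@[simp] theorem lo_ofBounds : (ofBounds ax s t s' t' h h').lo ax = s := by cases ax <;> rfl
@[simp] theorem hi_ofBounds : (ofBounds ax s t s' t' h h').hi ax = t := by cases ax <;> rfl
@[simp] theorem lo_flip_ofBounds : (ofBounds ax s t s' t' h h').lo ax.flip = s' := by
  cases ax <;> rfl
@[simp] theorem hi_flip_ofBounds : (ofBounds ax s t s' t' h h').hi ax.flip = t' := by
  cases ax <;> rfl

end

end Rect

/-! ### The lattice -/

theorem proj_eq_proj {p q : ℝ × ℝ} : proj Λ p = proj Λ q ↔ p - q ∈ Λ := by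
  rw [proj, proj, eq_comm, QuotientAddGroup.eq, sub_eq_neg_add]

theorem proj_add (p q : ℝ × ℝ) : proj Λ (p + q) = proj Λ p + proj Λ q := rfl

/-- Bounded regions contain only finitely many points of `Λ`. -/
def LocallyFinite (Λ : AddSubgroup (ℝ × ℝ)) : Prop :=
  ∀ M : ℝ, {l | l ∈ Λ ∧ ∀ ax : Axis, |ax.crd l| ≤ M}.Finite

theorem locallyFinite_latticeOf {u v : ℝ × ℝ} (huv : LinearIndependent ℝ ![u, v]) :
    LocallyFinite (latticeOf u v) := by
  intro M
  let b := basisOfLinearIndependentOfCardEqFinrank huv (by simp)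
  have hb : range b = {u, v} := by simp [b, pair_comm]
  have hfin := ZSpan.setFinite_inter b (Metric.isBounded_closedBall (x := (0 : ℝ × ℝ)) (r := M))
  refine hfin.subset ?_
  rintro l ⟨hl, hM⟩
  refine ⟨?_, ?_⟩
  · rw [Metric.mem_closedBall, dist_zero_right, Prod.norm_def]
    exact max_le (hM .hor) (hM .ver)
  · rw [hb]
    obtain ⟨m, n, rfl⟩ := AddSubgroup.mem_closure_pair.1 hl
    exact Submodule.mem_span_pair.2 ⟨m, n, rfl⟩

theorem LocallyFinite.countable (h : LocallyFinite Λ) : Countable Λ := by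
  have : (Λ : Set (ℝ × ℝ)) ⊆ ⋃ n : ℕ, {l | l ∈ Λ ∧ ∀ ax : Axis, |ax.crd l| ≤ n} := by
    intro l hl
    obtain ⟨n, hn⟩ := exists_nat_ge (max |l.1| |l.2|)
    refine mem_iUnion.2 ⟨n, hl, fun ax => ?_⟩
    cases ax
    exacts [(le_max_left _ _).trans hn, (le_max_right _ _).trans hn]
  exact ((countable_iUnion fun n : ℕ => (h n).countable).mono this).to_subtype

/-- The lattice points on an axis, as a subgroup of the reals. -/
def axisPeriods (Λ : AddSubgroup (ℝ × ℝ)) (ax : Axis) : AddSubgroup ℝ where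
  carrier := {t | t • ax.vec ∈ Λ}
  zero_mem' := by simp
  add_mem' := by
    intro s t hs ht
    simpa [add_smul] using Λ.add_mem hs ht
  neg_mem' := by
    intro s hs
    simpa using Λ.neg_mem hs

theorem mem_axisPeriods {ax : Axis} {t : ℝ} : t ∈ axisPeriods Λ ax ↔ t • ax.vec ∈ Λ := Iff.rfl

theorem LocallyFinite.countable_axisPeriods (h : LocallyFinite Λ) (ax : Axis) :
    Countable (axisPeriods Λ ax) := by
  have := h.countable
  refine Function.Injective.countable
    (f := fun t : axisPeriods Λ ax => (⟨t.1 • ax.vec, t.2⟩ : Λ)) ?_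
  intro s t hst
  have := congrArg ax.crd (congrArg Subtype.val hst)
  exact Subtype.ext (by simpa using this)

/-- If a lattice has a nonzero vector on the axis, then the least positive one exists. -/
theorem LocallyFinite.minPeriod_spec (h : LocallyFinite Λ) (ax : Axis)
    (hex : ∃ t : ℝ, 0 < t ∧ t • ax.vec ∈ Λ) :
    0 < minPeriod Λ ax ∧ minPeriod Λ ax • ax.vec ∈ Λ ∧
      ∀ t : ℝ, 0 < t → t • ax.vec ∈ Λ → minPeriod Λ ax ≤ t := by
  obtain ⟨t₀, ht₀, hm₀⟩ := hex
  set S := {t : ℝ | 0 < t ∧ t • ax.vec ∈ Λ} with hS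
  have hfin : (S ∩ Iic t₀).Finite := by
    refine ((h t₀).image ax.crd).subset ?_
    rintro t ⟨⟨ht, hm⟩, htt⟩
    refine ⟨t • ax.vec, ⟨hm, fun bx => ?_⟩, by simp⟩
    rcases ax.eq_or_eq_flip bx with rfl | rfl
    · simpa [abs_of_pos ht] using htt
    · simpa using ht₀.le
  obtain ⟨m, hm, hmin⟩ := hfin.exists_minimalFor id _ ⟨t₀, ⟨ht₀, hm₀⟩, le_refl t₀⟩
  have hle : IsLeast S m := by
    refine ⟨hm.1, fun t ht => ?_⟩
    rcases le_total t t₀ with h1 | h1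
    · rcases le_total m t with h2 | h2
      · exact h2
      · exact hmin ⟨ht, h1⟩ h2
    · exact le_trans hm.2 h1
  have heq : minPeriod Λ ax = m := hle.csInf_eq
  rw [heq]
  exact ⟨hm.1.1, hm.1.2, fun t ht htm => hle.2 ⟨ht, htm⟩⟩

/-! ### Half-open tiles -/

/-- The half-open tiles and their translates do not overlap. -/
theorem Tiling.mem_unique (T : Tiling Λ) {i j : Fin T.k} {l m p : ℝ × ℝ} (hl : l ∈ Λ)
    (hm : m ∈ Λ) (hi : p - l ∈ (T.rect i).halfOpen) (hj : p - m ∈ (T.rect j).halfOpen) :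
    i = j ∧ l = m := by
  -- a small shift to the upper right moves the point into both open tiles
  obtain ⟨ε, hε, hεi, hεj⟩ : ∃ ε : ℝ, 0 < ε ∧ p + (ε, ε) - l ∈ (T.rect i).inner ∧
      p + (ε, ε) - m ∈ (T.rect j).inner := by
    have key : ∀ (R : Rect) (q : ℝ × ℝ), q ∈ R.halfOpen →
        ∀ᶠ ε in 𝓝[>] (0 : ℝ), q + (ε, ε) ∈ R.inner := by
      intro R q hq
      have hax : ∀ ax : Axis, ∀ᶠ ε in 𝓝[>] (0 : ℝ),
          R.lo ax < ax.crd (q + (ε, ε)) ∧ ax.crd (q + (ε, ε)) < R.hi ax := by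
        intro ax
        filter_upwards [Ioo_mem_nhdsGT (sub_pos.2 (hq ax).2)] with ε hε
        have h1 := hq ax
        have h2 : ax.crd (ε, ε) = ε := by cases ax <;> rfl
        rw [Axis.crd_add, h2]
        constructor <;> linarith [hε.1, hε.2]
      filter_upwards [hax .hor, hax .ver] with ε h1 h2
      exact Rect.mem_inner.2 fun ax => by cases ax; exacts [h1, h2]
    obtain ⟨ε, h1, h2, h3⟩ :=
      ((key _ _ hi).and ((key _ _ hj).and self_mem_nhdsWithin)).exists
    refine ⟨ε, h3, ?_, ?_⟩
    · rwa [add_sub_right_comm]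
    · rwa [add_sub_right_comm]
  have hproj : proj Λ (p + (ε, ε) - l) = proj Λ (p + (ε, ε) - m) := by
    rw [proj_eq_proj, sub_sub_sub_cancel_left]
    exact Λ.sub_mem hm hl
  by_cases hij : i = j
  · subst hij
    exact ⟨rfl, sub_right_injective (T.injOn_inner i hεi hεj hproj)⟩
  · exact absurd (mem_image_of_mem _ hεj)
      (hproj ▸ disjoint_left.1 (T.disjoint_inner i j hij) (mem_image_of_mem _ hεi))

/-- The half-open tiles and their translates cover the plane: since the closed tiles do so and are
locally finite, one of them contains points arbitrarily close to a given point on its upper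
right. -/
theorem Tiling.exists_mem (hΛ : LocallyFinite Λ) (T : Tiling Λ) (p : ℝ × ℝ) :
    ∃ i, ∃ l ∈ Λ, p - l ∈ (T.rect i).halfOpen := by
  obtain ⟨M, hM⟩ : ∃ M : ℝ, ∀ i ax, |(T.rect i).lo ax| ≤ M ∧ |(T.rect i).hi ax| ≤ M := by
    have hb : ∀ f : Fin T.k → ℝ, ∃ M, ∀ i, |f i| ≤ M := fun f =>
      ⟨∑ i, |f i|, fun i => Finset.single_le_sum (f := fun i => |f i|)
        (fun _ _ => abs_nonneg _) (Finset.mem_univ i)⟩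
    obtain ⟨M1, h1⟩ := hb fun i => (T.rect i).lo .hor
    obtain ⟨M2, h2⟩ := hb fun i => (T.rect i).hi .hor
    obtain ⟨M3, h3⟩ := hb fun i => (T.rect i).lo .ver
    obtain ⟨M4, h4⟩ := hb fun i => (T.rect i).hi .ver
    refine ⟨max (max M1 M2) (max M3 M4), fun i ax => ?_⟩
    cases ax
    · exact ⟨(h1 i).trans (by simp), (h2 i).trans (by simp)⟩
    · exact ⟨(h3 i).trans (by simp), (h4 i).trans (by simp)⟩
  obtain ⟨N, hN⟩ : ∃ N : ℝ, ∀ ax : Axis, |ax.crd p| ≤ N :=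
    ⟨max |p.1| |p.2|, fun ax => by cases ax; exacts [le_max_left _ _, le_max_right _ _]⟩
  have hfin : (univ ×ˢ {l | l ∈ Λ ∧ ∀ ax : Axis, |ax.crd l| ≤ N + 1 + M} :
      Set (Fin T.k × (ℝ × ℝ))).Finite := finite_univ.prod (hΛ _)
  have hcrd : ∀ (ax : Axis) (ε : ℝ), ax.crd (ε, ε) = ε := fun ax ε => by cases ax <;> rfl
  have hclosed : ∀ᶠ ε in 𝓝[>] (0 : ℝ), ∃ x ∈ (univ ×ˢ {l | l ∈ Λ ∧ ∀ ax : Axis,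
      |ax.crd l| ≤ N + 1 + M} : Set (Fin T.k × (ℝ × ℝ))),
      p + (ε, ε) - x.2 ∈ (T.rect x.1).toSet := by
    filter_upwards [Ioo_mem_nhdsGT one_pos] with ε hε
    have hc : proj Λ (p + (ε, ε)) ∈ ⋃ i, proj Λ '' (T.rect i).toSet := T.cover ▸ mem_univ _
    obtain ⟨i, q, hq, hqp⟩ := mem_iUnion.1 hc
    refine ⟨(i, p + (ε, ε) - q), ⟨mem_univ _, proj_eq_proj.1 hqp.symm, fun ax => ?_⟩, ?_⟩
    · have h1 := Rect.mem_toSet.1 hq ax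
      have h2 := hM i ax
      have h3 := hN ax
      simp only [Axis.crd_sub, Axis.crd_add, hcrd]
      rw [abs_le] at h2 h3 ⊢
      rw [abs_le] at h2
      constructor <;> linarith [hε.1, hε.2]
    · simpa using hq
  obtain ⟨⟨i, l⟩, ⟨-, hl, -⟩, hx⟩ : ∃ x ∈ (univ ×ˢ {l | l ∈ Λ ∧ ∀ ax : Axis,
      |ax.crd l| ≤ N + 1 + M} : Set (Fin T.k × (ℝ × ℝ))),
      ∃ᶠ ε in 𝓝[>] (0 : ℝ), p + (ε, ε) - x.2 ∈ (T.rect x.1).toSet := by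
    by_contra! hcon
    obtain ⟨ε, ⟨x, hx, hxm⟩, h2⟩ := (hclosed.and ((eventually_all_finite hfin).2 hcon)).exists
    exact h2 x hx hxm
  refine ⟨i, l, hl, fun ax => ⟨?_, ?_⟩⟩
  · by_contra! hlt
    have hev : ∀ᶠ ε in 𝓝[>] (0 : ℝ), ε < (T.rect i).lo ax - ax.crd (p - l) :=
      nhdsWithin_le_nhds (Iio_mem_nhds (sub_pos.2 hlt))
    obtain ⟨ε, h1, h2⟩ := (hx.and_eventually hev).exists
    have := (Rect.mem_toSet.1 h1 ax).1
    simp only [Axis.crd_sub, Axis.crd_add, hcrd] at this h2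
    linarith
  · obtain ⟨ε, h1, h2⟩ := (hx.and_eventually self_mem_nhdsWithin).exists
    have := (Rect.mem_toSet.1 h1 ax).2
    simp only [Axis.crd_sub, Axis.crd_add, hcrd] at this ⊢
    linarith [show (0 : ℝ) < ε from h2]

/-- A family of rectangles whose half-open versions partition the plane, up to translation by the
lattice, is a tiling. -/
def Tiling.ofHalfOpen (k : ℕ) (R : Fin k → Rect)
    (hex : ∀ p : ℝ × ℝ, ∃ i, ∃ l ∈ Λ, p - l ∈ (R i).halfOpen)
    (huniq : ∀ (i j : Fin k) (l m p : ℝ × ℝ), l ∈ Λ → m ∈ Λ → p - l ∈ (R i).halfOpen →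
      p - m ∈ (R j).halfOpen → i = j ∧ l = m) : Tiling Λ where
  k := k
  rect := R
  injOn_inner i p hp q hq hpq := by
    have h := huniq i i 0 (p - q) p Λ.zero_mem (proj_eq_proj.1 hpq)
      (by simpa using (R i).inner_subset_halfOpen hp)
      (by simpa using (R i).inner_subset_halfOpen hq)
    exact sub_eq_zero.1 h.2.symm
  disjoint_inner i j hij := by
    rw [disjoint_left]
    rintro _ ⟨p, hp, rfl⟩ ⟨q, hq, hqp⟩
    exact hij (huniq i j 0 (p - q) p Λ.zero_mem (proj_eq_proj.1 hqp.symm)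
      (by simpa using (R i).inner_subset_halfOpen hp)
      (by simpa using (R j).inner_subset_halfOpen hq)).1
  cover := by
    refine eq_univ_of_forall fun x => ?_
    obtain ⟨p, rfl⟩ := QuotientAddGroup.mk_surjective x
    obtain ⟨i, l, hl, hp⟩ := hex p
    refine mem_iUnion.2 ⟨i, p - l, (R i).halfOpen_subset_toSet hp, proj_eq_proj.2 ?_⟩
    simpa using hl

/-! ### Measure bounds -/

/-- If the translates of finitely many sets by a countable group cover a set that contains at most
one point of each orbit, then the measure of that set is at most the sum of their measures. -/
theorem volume_le_sum_of_cover {G ι : Type*} [AddCommGroup G] [MeasureSpace G] [MeasurableAdd G]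
    [(volume : Measure G).IsAddLeftInvariant] [Fintype ι] (H : AddSubgroup G) [Countable H]
    {S : Set G} (hS : MeasurableSet S) (hinj : ∀ p ∈ S, ∀ q ∈ S, p - q ∈ H → p = q)
    (A : ι → Set G) (hA : ∀ i, MeasurableSet (A i))
    (hcov : ∀ p ∈ S, ∃ i, ∃ l ∈ H, p - l ∈ A i) : volume S ≤ ∑ i, volume (A i) := by
  have hsub : S ⊆ ⋃ i, ⋃ l : H, (fun p => (l : G) + p) '' {p | (l : G) + p ∈ S ∧ p ∈ A i} := by
    intro p hp
    obtain ⟨i, l, hl, hpl⟩ := hcov p hp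
    exact mem_iUnion.2 ⟨i, mem_iUnion.2 ⟨⟨l, hl⟩, p - l, ⟨by simpa using hp, hpl⟩, by simp⟩⟩
  refine (measure_mono hsub).trans ((measure_iUnion_fintype_le _ _).trans
    (Finset.sum_le_sum fun i _ => ?_))
  refine (measure_iUnion_le _).trans ?_
  have hmeas : ∀ l : H, MeasurableSet {p | (l : G) + p ∈ S ∧ p ∈ A i} := fun l =>
    (measurable_const_add (l : G) hS).inter (hA i)
  have hdisj : Pairwise (Function.onFun Disjoint fun l : H => {p | (l : G) + p ∈ S ∧ p ∈ A i}) := by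
    intro l m hlm
    refine disjoint_left.2 fun p hp hq => hlm (Subtype.ext ?_)
    have := hinj _ hp.1 _ hq.1 (by simpa using H.sub_mem l.2 m.2)
    exact add_right_cancel this
  have htrans : ∀ l : H, volume ((fun p => (l : G) + p) '' {p | (l : G) + p ∈ S ∧ p ∈ A i}) =
      volume {p | (l : G) + p ∈ S ∧ p ∈ A i} := by
    intro l
    rw [image_add_left, measure_preimage_add]
  rw [tsum_congr htrans, ← measure_iUnion hdisj hmeas]
  exact measure_mono (iUnion_subset fun l p hp => hp.2)

theorem Rect.halfOpen_eq (R : Rect) : R.halfOpen = Ico R.a R.b ×ˢ Ico R.c R.d := by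
  ext p
  rw [Rect.mem_halfOpen_iff .hor]
  rfl

/-- The area of the torus is at most the total area of the tiles. -/
theorem covol_le_sum {u v : ℝ × ℝ} (huv : LinearIndependent ℝ ![u, v])
    (T : Tiling (latticeOf u v)) (ax : Axis) :
    covol u v ≤ ∑ i, (T.rect i).extent ax * (T.rect i).extent ax.flip := by
  have hΛ := locallyFinite_latticeOf huv
  have := hΛ.countable
  set f : ℝ × ℝ →ₗ[ℝ] ℝ × ℝ := Matrix.toLin (Module.Basis.finTwoProd ℝ) (Module.Basis.finTwoProd ℝ)
    !![u.1, v.1; u.2, v.2] with hf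
  have hfa : ∀ p : ℝ × ℝ, f p = p.1 • u + p.2 • v := by
    intro p
    rw [hf, Matrix.toLin_finTwoProd_apply]
    ext <;> simp <;> ring
  have hdet : LinearMap.det f = u.1 * v.2 - u.2 * v.1 := by
    rw [hf, LinearMap.det_toLin, Matrix.det_fin_two_of]; ring
  have hcomb : ∀ s t : ℝ, s • u + t • v = 0 → s = 0 ∧ t = 0 := LinearIndependent.pair_iff.1 huv
  have hinjf : Function.Injective f := by
    rw [← LinearMap.ker_eq_bot, LinearMap.ker_eq_bot']
    intro p hp
    obtain ⟨h1, h2⟩ := hcomb _ _ (by rw [← hfa, hp])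
    exact Prod.ext h1 h2
  have hcont : Continuous f := LinearMap.continuous_of_finiteDimensional f
  have hvol : volume (f '' (Ico 0 1 ×ˢ Ico 0 1)) = ENNReal.ofReal (covol u v) := by
    rw [Measure.addHaar_image_linearMap, hdet, Measure.volume_eq_prod, Measure.prod_prod]
    simp [covol]
  have hle := volume_le_sum_of_cover (latticeOf u v) (S := f '' (Ico 0 1 ×ˢ Ico 0 1))
    ((measurableSet_Ico.prod measurableSet_Ico).image_of_continuousOn_injOn hcont.continuousOn
      hinjf.injOn)
    (by
      rintro _ ⟨p, hp, rfl⟩ _ ⟨q, hq, rfl⟩ hpq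
      obtain ⟨m, n, hmn⟩ := AddSubgroup.mem_closure_pair.1 hpq
      rw [← map_sub, hfa] at hmn
      have h0 : (p.1 - q.1 - m) • u + (p.2 - q.2 - n) • v = 0 := by
        rw [sub_smul _ (m : ℝ), sub_smul _ (n : ℝ), Int.cast_smul_eq_zsmul, Int.cast_smul_eq_zsmul,
          sub_add_sub_comm, hmn]
        simp
      obtain ⟨h1, h2⟩ := hcomb _ _ h0
      have key : ∀ (x y : ℝ) (m : ℤ), x ∈ Ico (0 : ℝ) 1 → y ∈ Ico (0 : ℝ) 1 → x - y - m = 0 →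
          x = y := by
        intro x y m hx hy h
        have hm1 : (m : ℝ) < 1 := by linarith [hx.2, hy.1]
        have hm2 : (-1 : ℝ) < m := by linarith [hx.1, hy.2]
        have : m = 0 := by
          have h3 : m < 1 := by exact_mod_cast hm1
          have h4 : -1 < m := by exact_mod_cast hm2
          omega
        subst this
        simpa [sub_eq_zero] using h
      rw [show p = q from Prod.ext (key _ _ m hp.1 hq.1 h1) (key _ _ n hp.2 hq.2 h2)])
    (fun i => (T.rect i).halfOpen)
    (fun i => by rw [Rect.halfOpen_eq]; exact measurableSet_Ico.prod measurableSet_Ico)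
    (fun p _ => T.exists_mem hΛ p)
  have harea : ∀ i, volume (T.rect i).halfOpen =
      ENNReal.ofReal ((T.rect i).extent ax * (T.rect i).extent ax.flip) := by
    intro i
    rw [Rect.halfOpen_eq, Measure.volume_eq_prod, Measure.prod_prod, Real.volume_Ico,
      Real.volume_Ico, ENNReal.ofReal_mul ((T.rect i).extent_pos ax).le]
    cases ax
    · rfl
    · rw [mul_comm]; rfl
  have hpos : ∀ i, 0 ≤ (T.rect i).extent ax * (T.rect i).extent ax.flip := fun i =>
    mul_nonneg ((T.rect i).extent_pos ax).le ((T.rect i).extent_pos _).le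
  rw [hvol] at hle
  simp only [harea] at hle
  rw [← ENNReal.ofReal_sum_of_nonneg fun i _ => hpos i] at hle
  exact (ENNReal.ofReal_le_ofReal_iff (Finset.sum_nonneg fun i _ => hpos i)).1 hle

/-! ### Tilings without closed circles -/

/-- The sides of the tiles in the direction `ax`, one for each tile, are together shorter than
every period of the torus in that direction. -/
def Tiling.Short (T : Tiling Λ) (ax : Axis) : Prop :=
  ∀ t : ℝ, 0 < t → t • ax.vec ∈ Λ → ∑ i, (T.rect i).extent ax < t

theorem Tiling.k_pos (T : Tiling Λ) : 0 < T.k := by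
  rcases T with ⟨k, R, _, _, hc⟩
  rcases Nat.eq_zero_or_pos k with rfl | h
  · exact (univ_nonempty.ne_empty (hc.symm.trans (iUnion_of_empty _))).elim
  · exact h

/-- No tile is longer than a period of the torus. -/
theorem Tiling.smul_vec_notMem_of_lt_extent (T : Tiling Λ) {ax : Axis} (i : Fin T.k) {t : ℝ}
    (ht : 0 < t) (hlt : t < (T.rect i).extent ax) : t • ax.vec ∉ Λ := by
  intro hm
  have h := T.mem_unique (i := i) (j := i) (p := (T.rect i).origin + t • ax.vec) Λ.zero_mem hm
    (by simpa using (T.rect i).origin_add_mem_halfOpen ax ht.le hlt)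
    (by simpa using (T.rect i).origin_add_mem_halfOpen ax le_rfl (ht.trans hlt))
  have h2 := congrArg ax.crd h.2
  simp only [Axis.crd_zero, Axis.crd_vec] at h2
  exact ht.ne h2

/-- A tiling shorter than `m_x(Λ)` is short in the horizontal direction, and likewise vertically:
no tile is wider than the period `d_x`, so that the heights of the tiles add up to at least
`d(Λ) / d_x`. -/
theorem short_of_lt_mAxis {u v : ℝ × ℝ} (huv : LinearIndependent ℝ ![u, v])
    (T : Tiling (latticeOf u v)) (ax : Axis)
    (h : ((∑ i, (T.rect i).extent ax + ∑ i, (T.rect i).extent ax.flip : ℝ) : EReal) <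
      mAxis u v ax) : T.Short ax := by
  intro t ht htm
  rw [mAxis, if_pos ⟨t, ht.ne', htm⟩, EReal.coe_lt_coe_iff] at h
  obtain ⟨hd, hdm, hmin⟩ := (locallyFinite_latticeOf huv).minPeriod_spec ax ⟨t, ht, htm⟩
  set d := minPeriod (latticeOf u v) ax
  have hw : ∀ i, (T.rect i).extent ax ≤ d := by
    intro i
    by_contra! hlt
    exact T.smul_vec_notMem_of_lt_extent i hd hlt hdm
  have harea : covol u v / d ≤ ∑ i, (T.rect i).extent ax.flip := by
    rw [div_le_iff₀ hd, Finset.sum_mul]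
    refine (covol_le_sum huv T ax).trans (Finset.sum_le_sum fun i _ => ?_)
    rw [mul_comm]
    exact mul_le_mul_of_nonneg_left (hw i) ((T.rect i).extent_pos _).le
  have := hmin t ht htm
  linarith

/-- The point lies on the lower or left side of a half-open tile, in the direction `ax`. -/
def Tiling.OnSide (T : Tiling Λ) (ax : Axis) (p : ℝ × ℝ) : Prop :=
  ∃ i, ∃ l ∈ Λ, p - l ∈ (T.rect i).halfOpen ∧ ax.flip.crd (p - l) = (T.rect i).lo ax.flip

/-- In a short tiling, an arc made up of sides is at most as long as the sides of all tiles. -/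
theorem Tiling.Short.le_sum_of_onSide (hΛ : LocallyFinite Λ) {T : Tiling Λ} {ax : Axis}
    (hT : T.Short ax) {p : ℝ × ℝ} {ℓ : ℝ}
    (hcov : ∀ s ∈ Ico 0 ℓ, T.OnSide ax (p + s • ax.vec)) : ℓ ≤ ∑ i, (T.rect i).extent ax := by
  set W := ∑ i, (T.rect i).extent ax with hW
  have hW0 : 0 ≤ W := Finset.sum_nonneg fun i _ => ((T.rect i).extent_pos ax).le
  by_contra! hlt
  -- an arc a little longer than `W` does not meet any of its translates
  obtain ⟨m, hWm, hmℓ, hm⟩ : ∃ m, W < m ∧ m ≤ ℓ ∧ ∀ t, 0 < t → t • ax.vec ∈ Λ → m ≤ t := by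
    by_cases hex : ∃ t : ℝ, 0 < t ∧ t • ax.vec ∈ Λ
    · obtain ⟨hd, hdm, hmin⟩ := hΛ.minPeriod_spec ax hex
      exact ⟨min ℓ (minPeriod Λ ax), lt_min hlt (hT _ hd hdm), min_le_left _ _,
        fun t h0 h1 => (min_le_right _ _).trans (hmin t h0 h1)⟩
    · push Not at hex
      exact ⟨ℓ, hlt, le_rfl, fun t h0 h1 => absurd h1 (hex t h0)⟩
  have := hΛ.countable_axisPeriods ax
  classical
  -- for each tile, a translate whose side lies on the line through `p`, if there is one
  let P : Fin T.k → ℝ × ℝ → Prop := fun i l =>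
    l ∈ Λ ∧ ax.flip.crd (p - l) = (T.rect i).lo ax.flip
  let x : Fin T.k → ℝ := fun i =>
    if h : ∃ l, P i l then (T.rect i).lo ax - ax.crd (p - h.choose) else 0
  have hle := volume_le_sum_of_cover (axisPeriods Λ ax) (S := Ico 0 m) measurableSet_Ico
    (by
      intro s hs t ht hst
      rw [mem_axisPeriods] at hst
      rcases lt_trichotomy s t with h | h | h
      · have h1 := hm (t - s) (sub_pos.2 h) (by
          have := Λ.neg_mem hst
          rwa [← neg_smul, neg_sub] at this)
        linarith [hs.1, ht.2]
      · exact h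
      · have h1 := hm (s - t) (sub_pos.2 h) hst
        linarith [ht.1, hs.2])
    (fun i => Ico (x i) (x i + (T.rect i).extent ax)) (fun i => measurableSet_Ico)
    (by
      intro s hs
      obtain ⟨i, l, hl, hmem, hside⟩ := hcov s ⟨hs.1, hs.2.trans_le hmℓ⟩
      have hP : P i l := ⟨hl, by simpa using hside⟩
      have hPex : ∃ l, P i l := ⟨l, hP⟩
      have hxi : x i = (T.rect i).lo ax - ax.crd (p - hPex.choose) := dif_pos hPex
      set m' := hPex.choose
      have hspec : P i m' := hPex.choose_spec
      have hdiff : ax.flip.crd (l - m') = 0 := by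
        have h1 := hP.2
        have h2 := hspec.2
        simp only [Axis.crd_sub] at h1 h2 ⊢
        linarith
      refine ⟨i, ax.crd (l - m'), ?_, ?_⟩
      · rw [mem_axisPeriods, ← Axis.eq_smul_vec hdiff]
        exact Λ.sub_mem hl hspec.1
      · have h1 := hmem ax
        rw [hxi, Rect.extent_eq]
        simp only [Axis.crd_sub, Axis.crd_add, Axis.crd_vec] at h1 ⊢
        constructor <;> linarith)
  simp only [Real.volume_Ico, sub_zero, add_sub_cancel_left] at hle
  rw [← ENNReal.ofReal_sum_of_nonneg fun i _ => ((T.rect i).extent_pos ax).le,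
    ENNReal.ofReal_le_ofReal_iff hW0] at hle
  linarith

/-! ### Partitions of a line into intervals -/

/-- The intervals `[c i, d i)` partition the line, and their lengths are bounded from below. -/
structure Stack {ι : Type*} (c d : ι → ℝ) : Prop where
  gap : ∃ h > 0, ∀ i, c i + h ≤ d i
  cover : ∀ y, ∃ i, c i ≤ y ∧ y < d i
  uniq : ∀ i j y, c i ≤ y → y < d i → c j ≤ y → y < d j → i = j

namespace Stack

variable {ι : Type*} {c d : ι → ℝ}

theorem lt (h : Stack c d) (i : ι) : c i < d i := by
  obtain ⟨g, hg, hgap⟩ := h.gap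
  linarith [hgap i]

theorem le_of_lt (h : Stack c d) {i j : ι} (hij : c i ≤ c j) (hne : i ≠ j) : d i ≤ c j := by
  by_contra! hlt
  exact hne (h.uniq i j (c j) hij hlt le_rfl (h.lt j))

theorem exists_succ (h : Stack c d) (i : ι) : ∃ j, c j = d i := by
  obtain ⟨j, hj, hj'⟩ := h.cover (d i)
  refine ⟨j, hj.antisymm ?_⟩
  by_contra! hlt
  have := h.uniq i j (max (c i) (c j)) (le_max_left _ _) (max_lt (h.lt i) hlt) (le_max_right _ _)
    (max_lt ((h.lt i).trans hj') (h.lt j))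
  subst this
  exact hj'.false

/-- A property that passes from each interval to the next one passes to all later ones. -/
theorem induct (h : Stack c d) {P : ι → Prop} (step : ∀ i j, d i = c j → P i → P j) {i j : ι}
    (hij : c i ≤ c j) (hi : P i) : P j := by
  obtain ⟨g, hg, hgap⟩ := h.gap
  obtain ⟨n, hn⟩ := exists_nat_ge ((c j - c i) / g)
  rw [div_le_iff₀ hg] at hn
  induction n generalizing i with
  | zero =>
    by_cases hne : i = j
    · exact hne ▸ hi
    · have := h.le_of_lt hij hne
      have := h.lt i
      simp only [Nat.cast_zero, zero_mul] at hn
      linarith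
  | succ n ih =>
    by_cases hne : i = j
    · exact hne ▸ hi
    · obtain ⟨k, hk⟩ := h.exists_succ i
      have hd := h.le_of_lt hij hne
      refine ih (by rw [hk]; exact hd) (step i k hk.symm hi) ?_
      have := hgap i
      push_cast at hn
      linarith

/-- If the end points of the intervals are displaced in such a way that adjacent intervals stay
adjacent and none gets a negative length, then the new intervals still partition the line. -/
theorem deform (h : Stack c d) {α β : ι → ℝ} {M : ℝ} (hM : ∀ i, |α i| ≤ M)
    (hle : ∀ i, c i + α i ≤ d i + β i) (hαβ : ∀ i j, d i = c j → β i = α j) :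
    (∀ y, ∃ i, c i + α i ≤ y ∧ y < d i + β i) ∧
    ∀ i j y, c i + α i ≤ y → y < d i + β i → c j + α j ≤ y → y < d j + β j → i = j := by
  constructor
  · intro y
    by_contra! hcon
    obtain ⟨i, hi, -⟩ := h.cover (y - M)
    obtain ⟨j, -, hj⟩ := h.cover (y + M)
    obtain ⟨k, hk⟩ := h.exists_succ j
    have hMi := abs_le.1 (hM i)
    have hMk := abs_le.1 (hM k)
    have := h.induct (P := fun m => c m + α m ≤ y) (i := i) (j := k)
      (fun m n hmn hm => by
        have h1 := hcon m hm
        rw [hαβ m n hmn, hmn] at h1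
        exact h1) (by linarith) (by linarith)
    linarith
  · have key : ∀ i j y, c i ≤ c j → y < d i + β i → c j + α j ≤ y → i = j := by
      intro i j y hij hy hy'
      by_contra hne
      have hd := h.le_of_lt hij hne
      obtain ⟨k, hk⟩ := h.exists_succ i
      have := h.induct (P := fun m => d i + β i ≤ c m + α m) (i := k) (j := j)
        (fun m n hmn hm => by
          have h1 := hle m
          have h2 := hαβ m n hmn
          linarith) (by linarith) (by rw [hk, hαβ i k hk.symm])
      linarith
    intro i j y h1 h2 h3 h4
    rcases le_total (c i) (c j) with hij | hij
    · exact key i j y hij h2 h3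
    · exact (key j i y hij h4 h1).symm

end Stack

/-! ### Sliding sides of tiles -/

namespace Tiling

/-- The translates of tiles that meet the line across the axis `ax` at the position `s`. -/
abbrev Column (T : Tiling Λ) (ax : Axis) (s : ℝ) : Type :=
  {x : Fin T.k × (ℝ × ℝ) // x.2 ∈ Λ ∧
    (T.rect x.1).lo ax ≤ s - ax.crd x.2 ∧ s - ax.crd x.2 < (T.rect x.1).hi ax}

theorem stack_column (hΛ : LocallyFinite Λ) (T : Tiling Λ) (ax : Axis) (s : ℝ) :
    Stack (fun x : T.Column ax s => (T.rect x.1.1).lo ax.flip + ax.flip.crd x.1.2)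
      (fun x => (T.rect x.1.1).hi ax.flip + ax.flip.crd x.1.2) where
  gap := by
    have : Nonempty (Fin T.k) := ⟨⟨0, T.k_pos⟩⟩
    obtain ⟨i, hi⟩ := Finite.exists_min fun i => (T.rect i).extent ax.flip
    refine ⟨_, (T.rect i).extent_pos ax.flip, fun x => ?_⟩
    have := hi x.1.1
    rw [(T.rect x.1.1).extent_eq] at this
    linarith
  cover y := by
    obtain ⟨i, l, hl, hp⟩ := T.exists_mem hΛ (s • ax.vec + y • ax.flip.vec)
    rw [Rect.mem_halfOpen_iff ax] at hp
    have hy : ax.flip.crd (y • ax.flip.vec) = y := Axis.crd_vec _ _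
    simp only [Axis.crd_sub, Axis.crd_add, Axis.crd_vec, Axis.crd_vec_flip, Axis.crd_flip_vec,
      hy, add_zero, zero_add] at hp
    refine ⟨⟨(i, l), hl, hp.1⟩, ?_, ?_⟩
    · linarith [hp.2.1]
    · linarith [hp.2.2]
  uniq := by
    rintro ⟨⟨i, l⟩, hl, hi⟩ ⟨⟨j, m⟩, hm, hj⟩ y h1 h2 h3 h4
    have hy : ax.flip.crd (y • ax.flip.vec) = y := Axis.crd_vec _ _
    have key : ∀ (i : Fin T.k) (l : ℝ × ℝ),
        ((T.rect i).lo ax ≤ s - ax.crd l ∧ s - ax.crd l < (T.rect i).hi ax) →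
        (T.rect i).lo ax.flip + ax.flip.crd l ≤ y → y < (T.rect i).hi ax.flip + ax.flip.crd l →
        (s • ax.vec + y • ax.flip.vec) - l ∈ (T.rect i).halfOpen := by
      intro i l h h' h''
      rw [Rect.mem_halfOpen_iff ax]
      simp only [Axis.crd_sub, Axis.crd_add, Axis.crd_vec, Axis.crd_vec_flip, Axis.crd_flip_vec,
        hy, add_zero, zero_add]
      exact ⟨h, by linarith, by linarith⟩
    obtain ⟨rfl, rfl⟩ := T.mem_unique hl hm (key i l hi h1 h2) (key j m hj h3 h4)
    rfl

/-- The far side of tile `i` in the direction `ax` overlaps the near side of tile `j`: for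
`ax = hor`, some translate of `j` lies directly above `i`. -/
def Below (T : Tiling Λ) (ax : Axis) (i j : Fin T.k) : Prop :=
  ∃ l ∈ Λ, ∃ m ∈ Λ, ∃ s : ℝ,
    ((T.rect i).lo ax ≤ s - ax.crd l ∧ s - ax.crd l < (T.rect i).hi ax) ∧
    ((T.rect j).lo ax ≤ s - ax.crd m ∧ s - ax.crd m < (T.rect j).hi ax) ∧
    (T.rect i).hi ax.flip + ax.flip.crd l = (T.rect j).lo ax.flip + ax.flip.crd m

/-- A displacement of the sides of the tiles in the direction `ax`, by `α i` for the near side and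
`β i` for the far side of tile `i`, moves sides that overlap by the same amount. -/
def Compatible (T : Tiling Λ) (ax : Axis) (α β : Fin T.k → ℝ) : Prop :=
  ∀ i j, T.Below ax i j → β i = α j

/-- Half of the total perimeter of the tiles. -/
def halfPerimeter (T : Tiling Λ) : ℝ :=
  ∑ i, (T.rect i).extent .hor + ∑ i, (T.rect i).extent .ver

theorem halfPerimeter_eq (T : Tiling Λ) (ax : Axis) :
    T.halfPerimeter = ∑ i, (T.rect i).extent ax + ∑ i, (T.rect i).extent ax.flip := by
  cases ax
  · rfl
  · exact add_comm _ _

/-- Sliding sides until some tiles collapse: the tiles that keep a positive size form a tiling. -/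
theorem exists_slide (hΛ : LocallyFinite Λ) (T : Tiling Λ) (ax : Axis) (α β : Fin T.k → ℝ)
    (hc : T.Compatible ax α β) (hle : ∀ i, α i - β i ≤ (T.rect i).extent ax.flip)
    (hcol : ∃ i, α i - β i = (T.rect i).extent ax.flip) :
    ∃ T' : Tiling Λ, T'.k < T.k ∧
      T'.halfPerimeter ≤ T.halfPerimeter + ∑ i, (β i - α i) := by
  classical
  let J := {i : Fin T.k // (T.rect i).lo ax.flip + α i < (T.rect i).hi ax.flip + β i}
  let e : Fin (Fintype.card J) ≃ J := (Fintype.equivFin J).symm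
  let Q : J → Rect := fun i => Rect.ofBounds ax ((T.rect i.1).lo ax) ((T.rect i.1).hi ax)
    ((T.rect i.1).lo ax.flip + α i.1) ((T.rect i.1).hi ax.flip + β i.1)
    ((T.rect i.1).lo_lt_hi ax) i.2
  have hmem : ∀ (i : J) (q : ℝ × ℝ), q ∈ (Q i).halfOpen ↔
      ((T.rect i.1).lo ax ≤ ax.crd q ∧ ax.crd q < (T.rect i.1).hi ax) ∧
      (T.rect i.1).lo ax.flip + α i.1 ≤ ax.flip.crd q ∧
      ax.flip.crd q < (T.rect i.1).hi ax.flip + β i.1 := by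
    intro i q
    rw [Rect.mem_halfOpen_iff ax]
    simp [Q]
  have hdef : ∀ s : ℝ, _ := fun s => (T.stack_column hΛ ax s).deform
    (α := fun x => α x.1.1) (β := fun x => β x.1.1) (M := ∑ i, |α i|)
    (fun x => Finset.single_le_sum (f := fun i => |α i|)
        (fun _ _ => abs_nonneg _) (Finset.mem_univ x.1.1))
    (fun x => by
      have := hle x.1.1
      rw [Rect.extent_eq] at this
      linarith)
    (fun x y hxy => hc _ _ ⟨x.1.2, x.2.1, y.1.2, y.2.1, s, x.2.2, y.2.2, hxy⟩)
  let T' : Tiling Λ := Tiling.ofHalfOpen (Fintype.card J) (fun n => Q (e n))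
    (by
      intro p
      obtain ⟨⟨⟨i, l⟩, hl, hi⟩, h1, h2⟩ := (hdef (ax.crd p)).1 (ax.flip.crd p)
      dsimp only at h1 h2 hl hi
      refine ⟨e.symm ⟨i, by linarith⟩, l, hl, ?_⟩
      rw [Equiv.apply_symm_apply, hmem]
      simp only [Axis.crd_sub]
      exact ⟨hi, by linarith, by linarith⟩)
    (by
      intro a b l m p hl hm ha hb
      rw [hmem] at ha hb
      simp only [Axis.crd_sub] at ha hb
      have := (hdef (ax.crd p)).2 ⟨((e a).1, l), hl, ha.1⟩ ⟨((e b).1, m), hm, hb.1⟩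
        (ax.flip.crd p) (by dsimp only; linarith [ha.2.1]) (by dsimp only; linarith [ha.2.2])
        (by dsimp only; linarith [hb.2.1]) (by dsimp only; linarith [hb.2.2])
      have h' := congrArg Subtype.val this
      simp only [Prod.mk.injEq] at h'
      exact ⟨e.injective (Subtype.ext h'.1), h'.2⟩)
  have hsum : ∀ (g : Rect → ℝ), ∑ n, g (T'.rect n) = ∑ i : J, g (Q i) := fun g =>
    e.sum_comp fun i => g (Q i)
  have hsub : ∀ f : Fin T.k → ℝ, (∀ i, 0 ≤ f i) → ∑ i : J, f i.1 ≤ ∑ i, f i := by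
    intro f hf
    rw [← Finset.sum_subtype (Finset.univ.filter fun i : Fin T.k =>
      (T.rect i).lo ax.flip + α i < (T.rect i).hi ax.flip + β i) (by simp) f]
    exact Finset.sum_le_univ_sum_of_nonneg hf
  refine ⟨T', ?_, ?_⟩
  · obtain ⟨i, hi⟩ := hcol
    have : Fintype.card J < Fintype.card (Fin T.k) := Fintype.card_subtype_lt (x := i) (by
      rw [Rect.extent_eq] at hi
      linarith)
    exact this.trans_eq (Fintype.card_fin _)
  · rw [T'.halfPerimeter_eq ax, T.halfPerimeter_eq ax, hsum fun R => R.extent ax,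
      hsum fun R => R.extent ax.flip, add_assoc]
    refine add_le_add ?_ (Finset.sum_add_distrib (M := ℝ) ▸ ?_)
    · have h1 : ∀ i : J, (Q i).extent ax = (T.rect i.1).extent ax := fun i => by
        simp [Rect.extent_eq, Q]
      simp only [h1]
      exact hsub _ fun i => ((T.rect i).extent_pos ax).le
    · have h1 : ∀ i : J, (Q i).extent ax.flip =
          (T.rect i.1).extent ax.flip + (β i.1 - α i.1) := fun i => by
        simp only [Rect.extent_eq, Q, Rect.hi_flip_ofBounds, Rect.lo_flip_ofBounds]
        ring
      simp only [h1]
      exact hsub (fun i => (T.rect i).extent ax.flip + (β i - α i)) fun i => by linarith [hle i]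

/-- No tiling with fewer tiles has at most the same half-perimeter. -/
def Reduced (T : Tiling Λ) : Prop :=
  ∀ T' : Tiling Λ, T'.halfPerimeter ≤ T.halfPerimeter → T.k ≤ T'.k

/-- In a reduced tiling, every compatible displacement moves each tile as a whole: otherwise the
displacement or its opposite does not increase the perimeter, and following it until the first
tiles collapse leaves fewer tiles. -/
theorem Reduced.eq_of_compatible (hΛ : LocallyFinite Λ) {T : Tiling Λ} (hT : T.Reduced) {ax : Axis}
    {α β : Fin T.k → ℝ} (hc : T.Compatible ax α β) : α = β := by
  have key : ∀ α β : Fin T.k → ℝ, T.Compatible ax α β → ∑ i, (β i - α i) ≤ 0 →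
      ∀ i, α i ≤ β i := by
    intro α β hc hsum i
    by_contra! hi
    obtain ⟨m, hm, hmin⟩ := Finset.exists_min_image (Finset.univ.filter fun i => β i < α i)
      (fun i => (T.rect i).extent ax.flip / (α i - β i)) ⟨i, by simpa using hi⟩
    have hm' : 0 < α m - β m := by simpa using hm
    set t := (T.rect m).extent ax.flip / (α m - β m) with ht
    have ht0 : 0 < t := div_pos ((T.rect m).extent_pos _) hm'
    obtain ⟨T', hk, hp⟩ := T.exists_slide hΛ ax (fun i => t * α i) (fun i => t * β i)
      (fun i j hij => by simp only [hc i j hij])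
      (fun i => by
        rw [← mul_sub]
        by_cases hi : β i < α i
        · have := hmin i (by simpa using hi)
          rwa [le_div_iff₀ (sub_pos.2 hi)] at this
        · have := (T.rect i).extent_pos ax.flip
          nlinarith)
      ⟨m, by rw [← mul_sub, ht, div_mul_cancel₀ _ hm'.ne']⟩
    refine absurd (hT T' (hp.trans ?_)) hk.not_ge
    simp only [← mul_sub, ← Finset.mul_sum]
    nlinarith
  have main : ∀ α β : Fin T.k → ℝ, T.Compatible ax α β → ∑ i, (β i - α i) ≤ 0 → α = β := by
    intro α β hc hsum
    have hle := key α β hc hsum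
    have h0 := (Finset.sum_eq_zero_iff_of_nonneg fun i _ => sub_nonneg.2 (hle i)).1
      (hsum.antisymm (Finset.sum_nonneg fun i _ => sub_nonneg.2 (hle i)))
    funext i
    linarith [h0 i (Finset.mem_univ i)]
  rcases le_total (∑ i, (β i - α i)) 0 with h | h
  · exact main α β hc h
  · have := main (fun i => -α i) (fun i => -β i) (fun i j hij => by simp only [hc i j hij]) (by
      simp only [← neg_sub', Finset.sum_neg_distrib]
      linarith)
    funext i
    exact neg_injective (congrFun this i)

/-- In a short tiling, a displacement that moves each tile as a whole moves all of them by the same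
amount: otherwise, a line across `ax` separates tiles that move by different amounts, and consists
of sides only. -/
theorem Short.const_of_compatible (hΛ : LocallyFinite Λ) {T : Tiling Λ} {ax : Axis}
    (hT : T.Short ax.flip) {σ : Fin T.k → ℝ} (hc : T.Compatible ax σ σ) (i j : Fin T.k) :
    σ i = σ j := by
  have hcol : ∀ (s : ℝ) (x y : T.Column ax s), σ x.1.1 = σ y.1.1 := by
    intro s x y
    have hst := T.stack_column hΛ ax s
    have key : ∀ x y : T.Column ax s, (T.rect x.1.1).lo ax.flip + ax.flip.crd x.1.2 ≤
        (T.rect y.1.1).lo ax.flip + ax.flip.crd y.1.2 → σ y.1.1 = σ x.1.1 := fun x y hxy =>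
      hst.induct (P := fun z => σ z.1.1 = σ x.1.1)
        (fun m n hmn hm => (hc _ _ ⟨m.1.2, m.2.1, n.1.2, n.2.1, s, m.2.2, n.2.2, hmn⟩).symm.trans hm)
        hxy rfl
    rcases le_total ((T.rect x.1.1).lo ax.flip + ax.flip.crd x.1.2)
      ((T.rect y.1.1).lo ax.flip + ax.flip.crd y.1.2) with h | h
    · exact (key x y h).symm
    · exact key y x h
  have hne : ∀ s : ℝ, Nonempty (T.Column ax s) := fun s =>
    let ⟨x, _⟩ := (T.stack_column hΛ ax s).cover 0; ⟨x⟩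
  -- the common displacement of the tiles that meet the line at the position `s`
  let S : ℝ → ℝ := fun s => σ (hne s).some.1.1
  have hS : ∀ (s : ℝ) (x : T.Column ax s), S s = σ x.1.1 := fun s x => hcol s _ _
  suffices hconst : ∀ s t : ℝ, s ≤ t → S s = S t by
    have hi : ∀ i, S ((T.rect i).lo ax) = σ i := fun i =>
      hS _ ⟨(i, 0), Λ.zero_mem, by simp, by simpa using (T.rect i).lo_lt_hi ax⟩
    rw [← hi i, ← hi j]
    rcases le_total ((T.rect i).lo ax) ((T.rect j).lo ax) with h | h
    · exact hconst _ _ h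
    · exact (hconst _ _ h).symm
  intro s t hst
  by_contra hne'
  let A : Set ℝ := {x | s ≤ x ∧ x ≤ t ∧ ∀ z, s ≤ z → z ≤ x → S z = S s}
  have hsA : s ∈ A := ⟨le_rfl, hst, fun z h1 h2 => by rw [le_antisymm h2 h1]⟩
  have hbdd : BddAbove A := ⟨t, fun x hx => hx.2.1⟩
  set r := sSup A with hr
  have hsr : s ≤ r := le_csSup hbdd hsA
  have hrt : r ≤ t := csSup_le ⟨s, hsA⟩ fun x hx => hx.2.1
  have hbelow : ∀ z, s ≤ z → z < r → S z = S s := by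
    intro z h1 h2
    obtain ⟨x, hx, hzx⟩ := exists_lt_of_lt_csSup ⟨s, hsA⟩ h2
    exact hx.2.2 z h1 hzx.le
  have hSr : S r ≠ S s := by
    intro heq
    have hrA : ∀ z, s ≤ z → z ≤ r → S z = S s := fun z h1 h2 => by
      rcases h2.lt_or_eq with h | rfl
      exacts [hbelow z h1 h, heq]
    have hlt : r < t := hrt.lt_of_ne fun h => hne' (h ▸ heq.symm)
    obtain ⟨x⟩ := hne r
    have hx := x.2.2
    set b := (T.rect x.1.1).hi ax + ax.crd x.1.2 with hb
    have hrb : r < b := by linarith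
    have hsame : ∀ z, r ≤ z → z < b → S z = S r := fun z h1 h2 => by
      rw [hS r x]
      exact hS z ⟨x.1, x.2.1, by linarith, by linarith⟩
    obtain ⟨z, hz1, hz2⟩ := exists_between (lt_min hlt hrb)
    have hzA : z ∈ A := by
      refine ⟨hsr.trans hz1.le, (hz2.trans_le (min_le_left _ _)).le, fun w h1 h2 => ?_⟩
      rcases le_total w r with h | h
      · exact hrA w h1 h
      · rw [hsame w h (h2.trans_lt (hz2.trans_le (min_le_right _ _))), heq]
    exact absurd (le_csSup hbdd hzA) (by rw [← hr]; exact hz1.not_ge)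
  have hsr' : s < r := hsr.lt_of_ne fun h => hSr (by rw [← h])
  set ℓ := ∑ i, (T.rect i).extent ax.flip + 1 with hℓ
  have := hT.le_sum_of_onSide hΛ (p := r • ax.vec) (ℓ := ℓ) (by
    intro y _
    obtain ⟨i, l, hl, hmem⟩ := T.exists_mem hΛ (r • ax.vec + y • ax.flip.vec)
    refine ⟨i, l, hl, hmem, ?_⟩
    have h1 := hmem ax
    rw [Axis.flip_flip]
    simp only [Axis.crd_sub, Axis.crd_add, Axis.crd_vec, Axis.crd_vec_flip, add_zero] at h1 ⊢
    by_contra hlo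
    have hlt : (T.rect i).lo ax + ax.crd l < r := by
      have := lt_of_le_of_ne h1.1 (Ne.symm hlo)
      linarith
    obtain ⟨z, hz1, hz2⟩ := exists_between (max_lt hlt hsr')
    have hz3 := (le_max_left _ _).trans_lt hz1
    have hz4 := (le_max_right _ _).trans_lt hz1
    have e1 := hS r ⟨(i, l), hl, h1⟩
    have e2 := hS z ⟨(i, l), hl, by linarith, by linarith⟩
    exact hSr (e1.trans (e2.symm.trans (hbelow z hz4.le hz2))))
  linarith

end Tiling

/-! ### Arcs along a segment -/

/-- The arcs into which a segment starting at `p` in the direction `ax` is cut at the given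
distances from `p`. -/
def arcsOf (Λ : AddSubgroup (ℝ × ℝ)) (ax : Axis) (p : ℝ × ℝ) : List ℝ → List (Arc Λ)
  | x :: y :: l => ⟨ax, proj Λ (p + x • ax.vec), y - x⟩ :: arcsOf Λ ax p (y :: l)
  | _ => []

section arcsOf

variable (ax : Axis) (p : ℝ × ℝ)

theorem finish_mk (x y : ℝ) :
    (⟨ax, proj Λ (p + x • ax.vec), y - x⟩ : Arc Λ).finish = proj Λ (p + y • ax.vec) := by
  rw [Arc.finish, ← proj_add, add_assoc, ← add_smul, add_sub_cancel]

theorem map_finish_arcsOf (x : ℝ) (l : List ℝ) :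
    (arcsOf Λ ax p (x :: l)).map Arc.finish = l.map fun s => proj Λ (p + s • ax.vec) := by
  induction l generalizing x with
  | nil => rfl
  | cons y l ih => rw [arcsOf, List.map_cons, List.map_cons, ih, finish_mk]

theorem vertexSeq_arcsOf (x y : ℝ) (l : List ℝ) :
    Tiling.vertexSeq (arcsOf Λ ax p (x :: y :: l)) =
      (x :: y :: l).map fun s => proj Λ (p + s • ax.vec) := by
  rw [List.map_cons, ← map_finish_arcsOf ax p x (y :: l)]
  rfl

theorem isChain_arcsOf (l : List ℝ) :
    (arcsOf Λ ax p l).IsChain fun e f => e.finish = f.start := by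
  induction l with
  | nil => exact .nil
  | cons x l ih =>
    match l with
    | [] => exact .nil
    | [y] => exact .singleton _
    | y :: z :: l => exact .cons_cons (finish_mk ax p x y) ih

theorem sum_len_arcsOf (x : ℝ) (l : List ℝ) :
    ((arcsOf Λ ax p (x :: l)).map Arc.len).sum = (x :: l).getLast (by simp) - x := by
  induction l generalizing x with
  | nil => simp [arcsOf]
  | cons y l ih =>
    rw [arcsOf, List.map_cons, List.sum_cons, ih, List.getLast_cons_cons]
    ring

theorem nodup_map_proj {l : List ℝ} (hl : l.Pairwise (· < ·))
    (hper : ∀ s ∈ l, ∀ t ∈ l, s < t → (t - s) • ax.vec ∉ Λ) :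
    (l.map fun s => proj Λ (p + s • ax.vec)).Nodup := by
  rw [List.Nodup, List.pairwise_map]
  refine hl.imp_of_mem fun {s t} hs ht hst heq => hper s hs t ht hst ?_
  rwa [eq_comm, proj_eq_proj, add_sub_add_left_eq_sub, ← sub_smul] at heq

theorem mem_arcsOf {l : List ℝ} (hl : l.Pairwise (· < ·)) {e : Arc Λ} :
    e ∈ arcsOf Λ ax p l ↔ ∃ x ∈ l, ∃ y ∈ l, x < y ∧ (∀ z ∈ l, z ∉ Ioo x y) ∧
      e = ⟨ax, proj Λ (p + x • ax.vec), y - x⟩ := by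
  induction l with
  | nil => simp [arcsOf]
  | cons a l ih =>
    match l with
    | [] =>
      simp only [arcsOf, List.not_mem_nil, List.mem_singleton, false_iff]
      rintro ⟨x, rfl, y, rfl, h, -⟩
      exact h.false
    | b :: l =>
      have ha := (List.pairwise_cons.1 hl).1
      have hbl := (List.pairwise_cons.1 hl).2
      have hb := (List.pairwise_cons.1 hbl).1
      rw [arcsOf, List.mem_cons, ih hbl]
      constructor
      · rintro (rfl | ⟨x, hx, y, hy, hxy, hz, rfl⟩)
        · refine ⟨a, by simp, b, by simp, ha b (by simp), fun z hz hzab => ?_, rfl⟩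
          rcases List.mem_cons.1 hz with rfl | hz
          · exact hzab.1.false
          · rcases List.mem_cons.1 hz with rfl | hz
            · exact hzab.2.false
            · exact (hb z hz).not_gt hzab.2
        · refine ⟨x, List.mem_cons_of_mem _ hx, y, List.mem_cons_of_mem _ hy, hxy,
            fun z hz' hzxy => ?_, rfl⟩
          rcases List.mem_cons.1 hz' with rfl | hz'
          · exact (ha x hx).not_gt hzxy.1
          · exact hz z hz' hzxy
      · rintro ⟨x, hx, y, hy, hxy, hz, rfl⟩
        have hy' : y ∈ b :: l := by
          rcases List.mem_cons.1 hy with rfl | hy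
          · rcases List.mem_cons.1 hx with rfl | hx
            · exact (hxy.false).elim
            · exact absurd (ha x hx) hxy.not_gt
          · exact hy
        rcases List.mem_cons.1 hx with rfl | hx
        · left
          rcases List.mem_cons.1 hy' with rfl | hy''
          · rfl
          · exact absurd ⟨ha b (by simp), hb y hy''⟩ (hz b (by simp))
        · right
          exact ⟨x, hx, y, hy', hxy, fun z hz' => hz z (List.mem_cons_of_mem _ hz'), rfl⟩

end arcsOf

namespace Tiling

theorem finite_vertices (T : Tiling Λ) : T.vertices.Finite :=
  finite_iUnion fun _ => Finite.image _ (by simp [Rect.corners])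

/-- The vertices on a segment that is not longer than the period cut it into a list of arcs. -/
theorem exists_cuts (T : Tiling Λ) (ax : Axis) (p : ℝ × ℝ) {ℓ : ℝ} (hℓ : 0 < ℓ)
    (hper : ∀ t, 0 < t → t < ℓ → t • ax.vec ∉ Λ) (h0 : proj Λ p ∈ T.vertices)
    (h1 : proj Λ (p + ℓ • ax.vec) ∈ T.vertices) :
    ∃ x y l, (x :: y :: l).Pairwise (· < ·) ∧
      (∀ s, s ∈ x :: y :: l ↔ s ∈ Icc 0 ℓ ∧ proj Λ (p + s • ax.vec) ∈ T.vertices) ∧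
      x = 0 ∧ (x :: y :: l).getLast (by simp) = ℓ := by
  set S := {s | s ∈ Icc 0 ℓ ∧ proj Λ (p + s • ax.vec) ∈ T.vertices} with hS
  have h0S : (0 : ℝ) ∈ S := ⟨⟨le_rfl, hℓ.le⟩, by simpa using h0⟩
  have h1S : ℓ ∈ S := ⟨⟨hℓ.le, le_rfl⟩, h1⟩
  have hfin : S.Finite := by
    have : (S ∩ Iio ℓ).Finite := by
      refine Finite.of_finite_image (f := fun s => proj Λ (p + s • ax.vec))
        (T.finite_vertices.subset ?_) ?_
      · rintro _ ⟨s, hs, rfl⟩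
        exact hs.1.2
      · have key : ∀ s ∈ S ∩ Iio ℓ, ∀ t ∈ S ∩ Iio ℓ,
            proj Λ (p + s • ax.vec) = proj Λ (p + t • ax.vec) → ¬ s < t := by
          intro s hs t ht hst hlt
          rw [eq_comm, proj_eq_proj, add_sub_add_left_eq_sub, ← sub_smul] at hst
          have h2 : t < ℓ := ht.2
          exact hper (t - s) (sub_pos.2 hlt) (by linarith [hs.1.1.1]) hst
        intro s hs t ht hst
        exact le_antisymm (not_lt.1 (key t ht s hs hst.symm)) (not_lt.1 (key s hs t ht hst))
    refine (this.union (finite_singleton ℓ)).subset fun s hs => ?_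
    rcases hs.1.2.lt_or_eq with h | h
    exacts [Or.inl ⟨hs, h⟩, Or.inr h]
  obtain ⟨L, hL, hLm⟩ : ∃ L : List ℝ, L.Pairwise (· < ·) ∧ ∀ s, s ∈ L ↔ s ∈ S :=
    ⟨hfin.toFinset.sort, (Finset.sortedLT_sort _).pairwise, fun s => by simp⟩
  match L, hL, hLm with
  | [], _, hLm => exact absurd ((hLm 0).2 h0S) (by simp)
  | [x], _, hLm =>
    have e0 := (hLm 0).2 h0S
    have e1 := (hLm ℓ).2 h1S
    simp only [List.mem_singleton] at e0 e1
    exact absurd (e0.trans e1.symm) hℓ.ne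
  | x :: y :: l, hL, hLm =>
    refine ⟨x, y, l, hL, hLm, ?_, ?_⟩
    · have hx := ((hLm x).1 (by simp)).1.1
      rcases List.mem_cons.1 ((hLm 0).2 h0S) with h | h
      · exact h.symm
      · linarith [(List.pairwise_cons.1 hL).1 0 h]
    · have hlast := ((hLm _).1 (List.getLast_mem (l := x :: y :: l) (by simp))).1.2
      refine hlast.antisymm ?_
      exact hL.imp le_of_lt |>.rel_getLast ((hLm ℓ).2 h1S)

/-! ### The length of the skeleton -/

/-- The corners of a tile, given by whether they lie on the near or far sides. -/
theorem proj_mem_vertices (T : Tiling Λ) (ax : Axis) (i : Fin T.k) {q : ℝ × ℝ}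
    (h : ax.crd q = (T.rect i).lo ax ∨ ax.crd q = (T.rect i).hi ax)
    (h' : ax.flip.crd q = (T.rect i).lo ax.flip ∨ ax.flip.crd q = (T.rect i).hi ax.flip) :
    proj Λ q ∈ T.vertices :=
  mem_iUnion.2 ⟨i, q, (Rect.mem_corners ax).2 ⟨h, h'⟩, rfl⟩

/-- Directly beyond each point of a far side, there is a tile whose near side contains the point. -/
theorem exists_below (hΛ : LocallyFinite Λ) (T : Tiling Λ) {ax : Axis} {i : Fin T.k}
    {l z : ℝ × ℝ} (hl : l ∈ Λ) (h1 : (T.rect i).lo ax ≤ ax.crd (z - l))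
    (h2 : ax.crd (z - l) < (T.rect i).hi ax) (h3 : ax.flip.crd (z - l) = (T.rect i).hi ax.flip) :
    ∃ j, ∃ m ∈ Λ, T.Below ax i j ∧ z - m ∈ (T.rect j).halfOpen ∧
      ax.flip.crd (z - m) = (T.rect j).lo ax.flip := by
  rw [Axis.crd_sub] at h1 h2 h3
  obtain ⟨⟨⟨j, m⟩, hm, hj⟩, hy⟩ :=
    (T.stack_column hΛ ax (ax.crd z)).exists_succ ⟨(i, l), hl, h1, h2⟩
  dsimp only at hm hj hy
  have hz : ax.flip.crd (z - m) = (T.rect j).lo ax.flip := by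
    rw [Axis.crd_sub]
    linarith
  refine ⟨j, m, hm, ⟨l, hl, m, hm, ax.crd z, ⟨h1, h2⟩, hj, hy.symm⟩, ?_, hz⟩
  rw [Rect.mem_halfOpen_iff ax, hz, Axis.crd_sub]
  exact ⟨hj, le_rfl, (T.rect j).lo_lt_hi _⟩

/-- A vertex-free arc that starts on the near side of a tile stays on this side, since the corners
of the tile are vertices. -/
theorem OnSide.exists_origin {T : Tiling Λ} {ax : Axis} {q : ℝ × ℝ} (h : T.OnSide ax q) {r : ℝ}
    (hno : ∀ r' ∈ Ioo 0 r, proj Λ (q + r' • ax.vec) ∉ T.vertices) :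
    ∃ j x, 0 ≤ x ∧ x + r ≤ (T.rect j).extent ax ∧
      ∀ r' : ℝ, proj Λ ((T.rect j).origin + (x + r') • ax.vec) = proj Λ (q + r' • ax.vec) := by
  obtain ⟨j, m, hm, hmem, hlo⟩ := h
  have hx := hmem ax
  set x := ax.crd (q - m) - (T.rect j).lo ax with hxdef
  have hqx : q - m = (T.rect j).origin + x • ax.vec :=
    Axis.ext_crd ax (by simp [hxdef]) (by simpa using hlo)
  have hproj : ∀ r : ℝ, proj Λ ((T.rect j).origin + (x + r) • ax.vec) =
      proj Λ (q + r • ax.vec) := by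
    intro r
    rw [add_smul, ← add_assoc, ← hqx, proj_eq_proj]
    convert Λ.neg_mem hm using 1
    abel
  refine ⟨j, x, by linarith, ?_, hproj⟩
  by_contra! hlt
  refine hno ((T.rect j).extent ax - x) ⟨?_, by linarith⟩ ?_
  · rw [Rect.extent_eq]
    linarith
  · rw [← hproj, add_sub_cancel]
    exact T.proj_mem_vertices ax j (Or.inr (by simp [Rect.extent_eq])) (Or.inl (by simp))

/-- An edge on the far side of a tile lies on the near side of another one. -/
theorem exists_near_side (hΛ : LocallyFinite Λ) (T : Tiling Λ) {e : Arc Λ} (he : e ∈ T.edges) :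
    ∃ i, ∃ s t : ℝ, 0 ≤ s ∧ s < t ∧ t ≤ (T.rect i).extent e.axis ∧
      proj Λ ((T.rect i).origin + s • e.axis.vec) ∈ T.vertices ∧
      proj Λ ((T.rect i).origin + t • e.axis.vec) ∈ T.vertices ∧
      (∀ r ∈ Ioo s t, proj Λ ((T.rect i).origin + r • e.axis.vec) ∉ T.vertices) ∧
      e = ⟨e.axis, proj Λ ((T.rect i).origin + s • e.axis.vec), t - s⟩ := by
  obtain ⟨ax, st, len⟩ := e
  obtain ⟨i, q, hq, s, t, hs, hst, ht, hstart, hlen, hvs, hvt, hno⟩ := he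
  dsimp only at *
  subst hstart hlen
  obtain ⟨hqa, hqf⟩ := (Rect.mem_sideStarts ax).1 hq
  rw [Rect.extent_eq] at ht
  rcases hqf with hqf | hqf
  · have : q = (T.rect i).origin := Axis.ext_crd ax (by simpa using hqa) (by simpa using hqf)
    subst this
    rw [← Rect.extent_eq] at ht
    exact ⟨i, s, t, hs, hst, ht, hvs, hvt, hno, rfl⟩
  · obtain ⟨j, m, hm, -, hmem, hlo⟩ := T.exists_below hΛ (ax := ax) (i := i) (l := 0)
      (z := q + s • ax.vec) Λ.zero_mem
      (by simp only [sub_zero, Axis.crd_add, Axis.crd_vec]; linarith)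
      (by simp only [sub_zero, Axis.crd_add, Axis.crd_vec]; linarith)
      (by simp only [sub_zero, Axis.crd_add, Axis.crd_flip_vec]; linarith)
    have hshift : ∀ r : ℝ, q + s • ax.vec + r • ax.vec = q + (s + r) • ax.vec := fun r => by
      rw [add_smul, add_assoc]
    obtain ⟨j, x, hx0, hx, hproj⟩ := OnSide.exists_origin (T := T) (ax := ax) (r := t - s)
      ⟨j, m, hm, hmem, hlo⟩ fun r hr => by
        rw [hshift]
        exact hno _ ⟨by linarith [hr.1], by linarith [hr.2]⟩
    simp only [hshift] at hproj
    have hxs := hproj 0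
    have hxt := hproj (t - s)
    rw [add_zero, add_zero] at hxs
    rw [add_sub_cancel] at hxt
    refine ⟨j, x, x + (t - s), hx0, by linarith, hx, hxs ▸ hvs, hxt ▸ hvt, ?_, ?_⟩
    · intro r hr
      have := hno (s + (r - x)) ⟨by linarith [hr.1], by linarith [hr.2]⟩
      rwa [← hproj, add_sub_cancel] at this
    · rw [hxs, add_sub_cancel_left]

/-- The edges in one direction are together as long as one side of each tile in this direction. -/
theorem finsum_len_axis (hΛ : LocallyFinite Λ) (T : Tiling Λ) (ax : Axis) :
    {e ∈ T.edges | e.axis = ax}.Finite ∧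
      ∑ᶠ e ∈ {e ∈ T.edges | e.axis = ax}, e.len = ∑ i, (T.rect i).extent ax := by
  classical
  have hside : ∀ i, ∃ L : List (Arc Λ), L.Nodup ∧ (L.map Arc.len).sum = (T.rect i).extent ax ∧
      ∀ e, e ∈ L ↔ ∃ s t : ℝ, 0 ≤ s ∧ s < t ∧ t ≤ (T.rect i).extent ax ∧
        proj Λ ((T.rect i).origin + s • ax.vec) ∈ T.vertices ∧
        proj Λ ((T.rect i).origin + t • ax.vec) ∈ T.vertices ∧
        (∀ r ∈ Ioo s t, proj Λ ((T.rect i).origin + r • ax.vec) ∉ T.vertices) ∧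
        e = ⟨ax, proj Λ ((T.rect i).origin + s • ax.vec), t - s⟩ := by
    intro i
    have hper : ∀ t, 0 < t → t < (T.rect i).extent ax → t • ax.vec ∉ Λ := fun t h1 h2 =>
      T.smul_vec_notMem_of_lt_extent i h1 h2
    obtain ⟨x, y, l, hsort, hmem, rfl, hlast⟩ := T.exists_cuts ax (T.rect i).origin
      ((T.rect i).extent_pos ax) hper
      (T.proj_mem_vertices ax i (Or.inl (by simp)) (Or.inl (by simp)))
      (T.proj_mem_vertices ax i (Or.inr (by simp [Rect.extent_eq])) (Or.inl (by simp)))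
    refine ⟨arcsOf Λ ax (T.rect i).origin (0 :: y :: l), ?_, ?_, fun e => ?_⟩
    · refine List.Nodup.of_map Arc.finish ?_
      rw [map_finish_arcsOf]
      have htail := (List.pairwise_cons.1 hsort)
      refine nodup_map_proj _ _ htail.2 fun s hs t ht hst => ?_
      have h1 := htail.1 s hs
      have h2 := ((hmem t).1 (List.mem_cons_of_mem _ ht)).1.2
      exact hper (t - s) (sub_pos.2 hst) (by linarith)
    · rw [sum_len_arcsOf, hlast, sub_zero]
    · rw [mem_arcsOf _ _ hsort]
      constructor
      · rintro ⟨s, hs, t, ht, hst, hno, rfl⟩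
        have hs' := (hmem s).1 hs
        have ht' := (hmem t).1 ht
        refine ⟨s, t, hs'.1.1, hst, ht'.1.2, hs'.2, ht'.2, fun r hr hv => ?_, rfl⟩
        exact hno r ((hmem r).2
          ⟨⟨hs'.1.1.trans hr.1.le, hr.2.le.trans ht'.1.2⟩, hv⟩) hr
      · rintro ⟨s, t, hs, hst, ht, hvs, hvt, hno, rfl⟩
        exact ⟨s, (hmem s).2 ⟨⟨hs, hst.le.trans ht⟩, hvs⟩, t,
          (hmem t).2 ⟨⟨hs.trans hst.le, ht⟩, hvt⟩, hst,
          fun z hz hzst => hno z hzst ((hmem z).1 hz).2, rfl⟩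
  choose L hnodup hsum hL using hside
  have hunion : {e ∈ T.edges | e.axis = ax} = ⋃ i, ((L i).toFinset : Set (Arc Λ)) := by
    ext e
    simp only [mem_iUnion, List.coe_toFinset, mem_ofPred_eq, hL]
    constructor
    · rintro ⟨he, rfl⟩
      exact T.exists_near_side hΛ he
    · rintro ⟨i, s, t, hs, hst, ht, hvs, hvt, hno, rfl⟩
      exact ⟨⟨i, _, (Rect.mem_sideStarts ax).2 ⟨by simp, Or.inl (by simp)⟩, s, t, hs, hst, ht, rfl,
        rfl, hvs, hvt, hno⟩, rfl⟩
  have hdisj : Pairwise (Function.onFun Disjoint fun i => ((L i).toFinset : Set (Arc Λ))) := by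
    intro i j hij
    refine disjoint_left.2 fun e he he' => hij ?_
    simp only [List.coe_toFinset, mem_ofPred_eq, hL] at he he'
    obtain ⟨s, t, hs, hst, ht, -, -, -, rfl⟩ := he
    obtain ⟨s', t', hs', hst', ht', -, -, -, heq⟩ := he'
    have hpr := proj_eq_proj.1 (congrArg Arc.start heq)
    refine (T.mem_unique (p := (T.rect i).origin + s • ax.vec) Λ.zero_mem hpr ?_ ?_).1
    · simpa using (T.rect i).origin_add_mem_halfOpen ax hs (hst.trans_le ht)
    · simpa using (T.rect j).origin_add_mem_halfOpen ax hs' (hst'.trans_le ht')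
  rw [hunion]
  refine ⟨finite_iUnion fun i => Finset.finite_toSet _, ?_⟩
  rw [finsum_mem_iUnion hdisj fun i => Finset.finite_toSet _, finsum_eq_sum_of_fintype]
  refine Finset.sum_congr rfl fun i _ => ?_
  rw [finsum_mem_coe_finset, List.sum_toFinset _ (hnodup i), hsum]

/-- The length of the skeleton is half of the total perimeter of the tiles, since every edge lies
on exactly one lower or left side, and on exactly one upper or right side. -/
theorem length_eq_halfPerimeter (hΛ : LocallyFinite Λ) (T : Tiling Λ) :
    T.length = T.halfPerimeter := by
  obtain ⟨hf, hs⟩ := T.finsum_len_axis hΛ .hor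
  obtain ⟨hf', hs'⟩ := T.finsum_len_axis hΛ .ver
  have hunion : T.skeleton.edgeSet = {e ∈ T.edges | e.axis = .hor} ∪
      {e ∈ T.edges | e.axis = .ver} := by
    ext e
    change e ∈ T.edges ↔ _
    rcases he : e.axis <;> simp [he]
  rw [length, halfPerimeter, ← hs, ← hs', hunion, finsum_mem_union _ hf hf']
  refine disjoint_left.2 fun e he he' => ?_
  have := he.2.symm.trans he'.2
  cases this

end Tiling

/-! ### Reduced tilings have a single segment in each direction -/

namespace Tiling

theorem onSide_iff {T : Tiling Λ} {ax : Axis} {j : Fin T.k} {m q : ℝ × ℝ} (hm : m ∈ Λ)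
    (hq : q - m ∈ (T.rect j).halfOpen) :
    T.OnSide ax q ↔ ax.flip.crd (q - m) = (T.rect j).lo ax.flip := by
  refine ⟨?_, fun h => ⟨j, m, hm, hq, h⟩⟩
  rintro ⟨i, l, hl, hmem, h⟩
  obtain ⟨rfl, rfl⟩ := T.mem_unique hl hm hmem hq
  exact h

/-- In a reduced tiling, up to translation all near sides lie on one and the same segment, which is
made up of near sides, whose end points are vertices, and which is shorter than the period. It is
a maximal segment of this kind: the sides, near or far, that have a translate in it form a union of
classes of the overlap relation, and a reduced tiling has only one such class. -/
theorem exists_segment (hΛ : LocallyFinite Λ) {T : Tiling Λ} (hT : T.Reduced) {ax : Axis}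
    (hs : T.Short ax) (hs' : T.Short ax.flip) :
    ∃ (p : ℝ × ℝ) (ℓ : ℝ), 0 < ℓ ∧ (∀ t, 0 < t → t ≤ ℓ → t • ax.vec ∉ Λ) ∧
      proj Λ p ∈ T.vertices ∧ proj Λ (p + ℓ • ax.vec) ∈ T.vertices ∧
      (∀ s ∈ Ico 0 ℓ, T.OnSide ax (p + s • ax.vec)) ∧
      ∀ i, ∃ m ∈ Λ, (T.rect i).lo ax.flip + ax.flip.crd m = ax.flip.crd p ∧
        ax.crd p ≤ (T.rect i).lo ax + ax.crd m ∧ (T.rect i).hi ax + ax.crd m ≤ ax.crd p + ℓ := by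
  classical
  set i₀ : Fin T.k := ⟨0, T.k_pos⟩
  set p₀ := (T.rect i₀).origin with hp₀
  set W := ∑ i, (T.rect i).extent ax
  let f : ℝ → Prop := fun s => T.OnSide ax (p₀ + s • ax.vec)
  have hlen : ∀ x y, (∀ s ∈ Ico x y, f s) → y - x ≤ W := by
    intro x y h
    refine hs.le_sum_of_onSide hΛ (p := p₀ + x • ax.vec) fun s hs => ?_
    rw [add_assoc, ← add_smul]
    exact h _ ⟨by linarith [hs.1], by linarith [hs.2]⟩
  -- the part of a near or far side that lies on the line through `p₀` consists of near sides
  have hnear : ∀ j, ∀ m ∈ Λ, (T.rect j).lo ax.flip + ax.flip.crd m = ax.flip.crd p₀ →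
      ∀ s ∈ Ico ((T.rect j).lo ax + ax.crd m - ax.crd p₀)
        ((T.rect j).hi ax + ax.crd m - ax.crd p₀), f s := by
    intro j m hm hlo s hs
    have hlo' : ax.flip.crd (p₀ + s • ax.vec - m) = (T.rect j).lo ax.flip := by
      simp only [Axis.crd_sub, Axis.crd_add, Axis.crd_flip_vec]
      linarith
    refine ⟨j, m, hm, (Rect.mem_halfOpen_iff ax).2 ⟨?_, hlo'.ge, ?_⟩, hlo'⟩
    · simp only [Axis.crd_sub, Axis.crd_add, Axis.crd_vec]
      constructor <;> linarith [hs.1, hs.2]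
    · rw [hlo']
      exact (T.rect j).lo_lt_hi _
  have hfar : ∀ i, ∀ l ∈ Λ, (T.rect i).hi ax.flip + ax.flip.crd l = ax.flip.crd p₀ →
      ∀ s ∈ Ico ((T.rect i).lo ax + ax.crd l - ax.crd p₀)
        ((T.rect i).hi ax + ax.crd l - ax.crd p₀), f s := by
    intro i l hl hhi s hs
    obtain ⟨j, m, hm, -, hmem, hlo⟩ := T.exists_below hΛ (ax := ax) (i := i) (l := l)
      (z := p₀ + s • ax.vec) hl
      (by simp only [Axis.crd_sub, Axis.crd_add, Axis.crd_vec]; linarith [hs.1])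
      (by simp only [Axis.crd_sub, Axis.crd_add, Axis.crd_vec]; linarith [hs.2])
      (by simp only [Axis.crd_sub, Axis.crd_add, Axis.crd_flip_vec]; linarith)
    exact ⟨j, m, hm, hmem, hlo⟩
  have hlo₀ := (T.rect i₀).lo_lt_hi ax
  have hc₀ : ∀ bx : Axis, bx.crd p₀ = (T.rect i₀).lo bx := fun bx => by simp [hp₀]
  -- the maximal interval of near sides that contains the near side of the tile `i₀`
  let SA : Set ℝ := {x | x ≤ 0 ∧ ∀ s ∈ Ico x 0, f s}
  let SB : Set ℝ := {x | 0 ≤ x ∧ ∀ s ∈ Ico 0 x, f s}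
  have hSA0 : (0 : ℝ) ∈ SA := ⟨le_rfl, fun s hs => absurd hs.1 hs.2.not_ge⟩
  have hSAb : BddBelow SA := ⟨-W, fun x hx => by linarith [hlen x 0 hx.2]⟩
  have hSBb : BddAbove SB := ⟨W, fun x hx => by linarith [hlen 0 x hx.2]⟩
  have hSB1 : (T.rect i₀).hi ax - (T.rect i₀).lo ax ∈ SB := by
    refine ⟨by linarith, fun s hs => hnear i₀ 0 Λ.zero_mem (by simp [hc₀]) s ?_⟩
    simpa [hc₀] using hs
  set A := sInf SA with hA
  set B := sSup SB with hB
  have hA0 : A ≤ 0 := csInf_le hSAb hSA0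
  have hB0 : (T.rect i₀).hi ax - (T.rect i₀).lo ax ≤ B := le_csSup hSBb hSB1
  have hAB' : ∀ s, A < s → s < B → f s := by
    intro s h1 h2
    rcases lt_or_ge s 0 with h | h
    · obtain ⟨x, hx, hxs⟩ := exists_lt_of_csInf_lt ⟨0, hSA0⟩ h1
      exact hx.2 s ⟨hxs.le, h⟩
    · obtain ⟨x, hx, hxs⟩ := exists_lt_of_lt_csSup ⟨_, hSB1⟩ h2
      exact hx.2 s ⟨h, hxs⟩
  have hAB : ∀ s ∈ Ico A B, f s := by
    rintro s ⟨h1, h2⟩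
    obtain ⟨j, m, hm, hmem⟩ := T.exists_mem hΛ (p₀ + s • ax.vec)
    have hax := hmem ax
    simp only [Axis.crd_sub, Axis.crd_add, Axis.crd_vec] at hax
    obtain ⟨z, hz1, hz2⟩ := exists_between
      (lt_min h2 (show s < (T.rect j).hi ax + ax.crd m - ax.crd p₀ by linarith [hax.2]))
    have hz3 := hz2.trans_le (min_le_right _ _)
    have hfz := hAB' z (h1.trans_lt hz1) (hz2.trans_le (min_le_left _ _))
    have hmz : p₀ + z • ax.vec - m ∈ (T.rect j).halfOpen := by
      have hfl := hmem ax.flip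
      rw [Rect.mem_halfOpen_iff ax]
      simp only [Axis.crd_sub, Axis.crd_add, Axis.crd_vec, Axis.crd_flip_vec] at hfl ⊢
      exact ⟨⟨by linarith, by linarith⟩, hfl⟩
    have h3 := (onSide_iff hm hmz).1 hfz
    refine (onSide_iff hm hmem).2 ?_
    simpa using h3
  have hmax : ∀ x y, (∀ s ∈ Ico x y, f s) → x ≤ B → A ≤ y → A ≤ x ∧ y ≤ B := by
    intro x y hxy hx hy
    constructor
    · by_contra! hlt
      refine hlt.not_ge (csInf_le hSAb ⟨hlt.le.trans hA0, fun s hs => ?_⟩)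
      rcases lt_or_ge s A with h | h
      · exact hxy s ⟨hs.1, h.trans_le hy⟩
      · exact hAB s ⟨h, by linarith [hs.2]⟩
    · by_contra! hlt
      refine hlt.not_ge (le_csSup hSBb ⟨by linarith, fun s hs => ?_⟩)
      rcases lt_or_ge s B with h | h
      · exact hAB s ⟨hA0.trans hs.1, h⟩
      · exact hxy s ⟨hx.trans h, hs.2⟩
  -- the classes of sides with a translate in the interval
  let In : Fin T.k → ℝ → Prop := fun j c => ∃ m ∈ Λ, c + ax.flip.crd m = ax.flip.crd p₀ ∧
    A ≤ (T.rect j).lo ax + ax.crd m - ax.crd p₀ ∧ (T.rect j).hi ax + ax.crd m - ax.crd p₀ ≤ B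
  have hBelow : ∀ i j, T.Below ax i j →
      (In i ((T.rect i).hi ax.flip) ↔ In j ((T.rect j).lo ax.flip)) := by
    rintro i j ⟨l, hl, m, hm, s, hi, hj, heq⟩
    have hii := (T.rect i).lo_lt_hi ax
    have hjj := (T.rect j).lo_lt_hi ax
    constructor
    · rintro ⟨l', hl', hc, h1, h2⟩
      have hm' : m + (l' - l) ∈ Λ := Λ.add_mem hm (Λ.sub_mem hl' hl)
      have hh : (T.rect j).lo ax.flip + ax.flip.crd (m + (l' - l)) = ax.flip.crd p₀ := by
        simp only [Axis.crd_add, Axis.crd_sub]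
        linarith
      refine ⟨_, hm', hh, hmax _ _ (hnear j _ hm' hh) ?_ ?_⟩ <;>
        simp only [Axis.crd_add, Axis.crd_sub] <;> linarith
    · rintro ⟨m', hm', hc, h1, h2⟩
      have hl' : l + (m' - m) ∈ Λ := Λ.add_mem hl (Λ.sub_mem hm' hm)
      have hh : (T.rect i).hi ax.flip + ax.flip.crd (l + (m' - m)) = ax.flip.crd p₀ := by
        simp only [Axis.crd_add, Axis.crd_sub]
        linarith
      refine ⟨_, hl', hh, hmax _ _ (hfar i _ hl' hh) ?_ ?_⟩ <;>
        simp only [Axis.crd_add, Axis.crd_sub] <;> linarith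
  have hall : ∀ i, In i ((T.rect i).lo ax.flip) := by
    let α : Fin T.k → ℝ := fun i => if In i ((T.rect i).lo ax.flip) then 1 else 0
    let β : Fin T.k → ℝ := fun i => if In i ((T.rect i).hi ax.flip) then 1 else 0
    have hcomp : T.Compatible ax α β := fun i j hij => by
      simp only [α, β, hBelow i j hij]
    have hαβ : α = β := hT.eq_of_compatible hΛ hcomp
    have hcomp' : T.Compatible ax α α := hαβ ▸ hcomp
    have h0 : In i₀ ((T.rect i₀).lo ax.flip) :=
      ⟨0, Λ.zero_mem, by simp [hc₀], by simpa [hc₀] using hA0, by simpa [hc₀] using hB0⟩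
    intro i
    by_contra hi
    have := hs'.const_of_compatible hΛ hcomp' i₀ i
    simp [α, h0, hi] at this
  -- the near side through a given point of the segment
  have hside : ∀ s ∈ Ico A B, ∃ j, ∃ m ∈ Λ,
      (T.rect j).lo ax.flip + ax.flip.crd m = ax.flip.crd p₀ ∧
      s ∈ Ico ((T.rect j).lo ax + ax.crd m - ax.crd p₀)
        ((T.rect j).hi ax + ax.crd m - ax.crd p₀) ∧
      A ≤ (T.rect j).lo ax + ax.crd m - ax.crd p₀ ∧
      (T.rect j).hi ax + ax.crd m - ax.crd p₀ ≤ B := by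
    intro s hs
    obtain ⟨j, m, hm, hmem, hlo⟩ := hAB s hs
    have hax := hmem ax
    simp only [Axis.crd_sub, Axis.crd_add, Axis.crd_vec, Axis.crd_flip_vec] at hax hlo
    have hlo' : (T.rect j).lo ax.flip + ax.flip.crd m = ax.flip.crd p₀ := by linarith
    exact ⟨j, m, hm, hlo', ⟨by linarith, by linarith⟩,
      hmax _ _ (hnear j m hm hlo') (by linarith [hs.2]) (by linarith [hs.1])⟩
  have hlt : A < B := by linarith
  have hvert : ∀ (s : ℝ) (j : Fin T.k) (m : ℝ × ℝ), m ∈ Λ →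
      (T.rect j).lo ax.flip + ax.flip.crd m = ax.flip.crd p₀ →
      ((T.rect j).lo ax + ax.crd m - ax.crd p₀ = s ∨
        (T.rect j).hi ax + ax.crd m - ax.crd p₀ = s) → proj Λ (p₀ + s • ax.vec) ∈ T.vertices := by
    intro s j m hm hlo hor
    have : proj Λ (p₀ + s • ax.vec) = proj Λ (p₀ + s • ax.vec - m) := by
      rw [proj_eq_proj]
      simpa using hm
    rw [this]
    refine T.proj_mem_vertices ax j ?_ (Or.inl ?_)
    · simp only [Axis.crd_sub, Axis.crd_add, Axis.crd_vec]
      rcases hor with h | h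
      · left; linarith
      · right; linarith
    · simp only [Axis.crd_sub, Axis.crd_add, Axis.crd_flip_vec]
      linarith
  refine ⟨p₀ + A • ax.vec, B - A, sub_pos.2 hlt, ?_, ?_, ?_, ?_, ?_⟩
  · intro t ht htB htm
    have := hs t ht htm
    linarith [hlen A B hAB]
  · obtain ⟨j, m, hm, hlo, hmem, h1, -⟩ := hside A ⟨le_rfl, hlt⟩
    exact hvert A j m hm hlo (Or.inl (le_antisymm hmem.1 h1))
  · rw [add_assoc, ← add_smul, add_sub_cancel]
    have : Nonempty (Fin T.k) := ⟨i₀⟩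
    obtain ⟨i, hi⟩ := Finite.exists_min fun i => (T.rect i).extent ax
    set g := (T.rect i).extent ax
    have hg : 0 < g := (T.rect i).extent_pos ax
    -- a side that ends less than the length of a side before `B` is the last one
    have hsI : max A (B - g) ∈ Ico A B := ⟨le_max_left _ _, max_lt hlt (by linarith)⟩
    obtain ⟨j, m, hm, hlo, hmem, h1, h2⟩ := hside _ hsI
    rcases h2.lt_or_eq with h2 | h2
    · obtain ⟨j', m', hm', hlo', hmem', h1', h2'⟩ := hside _ ⟨(hsI.1.trans hmem.2.le), h2⟩
      have hg' := hi j'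
      rw [(T.rect j').extent_eq] at hg'
      have hself : ∀ (j : Fin T.k) (m : ℝ × ℝ) (s : ℝ),
          (T.rect j).lo ax.flip + ax.flip.crd m = ax.flip.crd p₀ →
          s ∈ Ico ((T.rect j).lo ax + ax.crd m - ax.crd p₀)
            ((T.rect j).hi ax + ax.crd m - ax.crd p₀) →
          p₀ + s • ax.vec - m ∈ (T.rect j).halfOpen := by
        intro j m s hlo hs
        have := (T.rect j).lo_lt_hi ax.flip
        rw [Rect.mem_halfOpen_iff ax]
        simp only [Axis.crd_sub, Axis.crd_add, Axis.crd_vec, Axis.crd_flip_vec]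
        refine ⟨⟨?_, ?_⟩, ?_, ?_⟩ <;> linarith [hs.1, hs.2]
      have hle : (T.rect j').lo ax + ax.crd m' - ax.crd p₀ ≤ max A (B - g) :=
        le_trans (by linarith) (le_max_right _ _)
      obtain ⟨rfl, rfl⟩ := T.mem_unique hm hm' (hself j m _ hlo hmem)
        (hself j' m' _ hlo' ⟨hle, hmem.2.trans hmem'.2⟩)
      exact absurd hmem'.2 (lt_irrefl _)
    · exact hvert B j m hm hlo (Or.inr h2)
  · intro s hs
    rw [add_assoc, ← add_smul]
    exact hAB _ ⟨by linarith [hs.1], by linarith [hs.2]⟩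
  · intro i
    obtain ⟨m, hm, hlo, h1, h2⟩ := hall i
    refine ⟨m, hm, ?_, ?_, ?_⟩ <;>
      simp only [Axis.crd_add, Axis.crd_vec, Axis.crd_flip_vec] <;> linarith

/-! ### The maximal path -/

/-- Consecutive arcs from a path without repeated vertices form a sub-path. -/
theorem isInfix_of_isChain {L Q : List (Arc Λ)} (hL : L.IsChain fun e f => e.finish = f.start)
    (hnodup : (vertexSeq L).Nodup) (hQ : Q.IsChain fun e f => e.finish = f.start)
    (hmem : ∀ e ∈ Q, e ∈ L) : Q <:+: L := by
  induction Q with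
  | nil => exact L.nil_infix
  | cons e Q ih =>
    have he := hmem e (by simp)
    match Q with
    | [] =>
      obtain ⟨A, B, rfl⟩ := List.append_of_mem he
      exact ⟨A, B, by simp⟩
    | f :: Q =>
      obtain ⟨hef, hQ'⟩ := List.isChain_cons_cons.1 hQ
      obtain ⟨A, B, hAB⟩ := ih hQ' fun g hg => hmem g (List.mem_cons_of_mem _ hg)
      rcases List.eq_nil_or_concat A with rfl | ⟨A, a, rfl⟩
      · -- `f` cannot be the first arc, as its start is the end of `e`
        subst hAB
        have := (List.nodup_cons.1 hnodup).1
        exact absurd (List.mem_map.2 ⟨e, he, hef⟩) this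
      · have hfin : (L.map Arc.finish).Nodup := by
          match L, hnodup with
          | [], _ => exact List.nodup_nil
          | g :: L, h => exact (List.nodup_cons.1 h).2
        have haf : a.finish = f.start := by
          rw [← hAB, List.concat_eq_append, List.append_assoc, List.append_assoc] at hL
          have h1 := (List.isChain_append.1 hL).2.1
          exact (List.isChain_cons_cons.1 h1).1
        have ha : a ∈ L := by simp [← hAB]
        have : a = e := List.inj_on_of_nodup_map hfin ha he (haf.trans hef.symm)
        subst this
        exact ⟨A, B, by simpa using hAB⟩

/-- In each direction, the skeleton of a reduced tiling has exactly one maximal path: the edges on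
its only segment. -/
theorem existsUnique_isMaximalAxisPath (hΛ : LocallyFinite Λ) {T : Tiling Λ} (hT : T.Reduced)
    {ax : Axis} (hs : T.Short ax) (hs' : T.Short ax.flip) :
    ∃! P, T.IsMaximalAxisPath ax P := by
  obtain ⟨p, ℓ, hℓ, hper, hv0, hv1, hside, hall⟩ := exists_segment hΛ hT hs hs'
  obtain ⟨x, y, l, hsort, hmem, hx0, -⟩ :=
    T.exists_cuts ax p hℓ (fun t h1 h2 => hper t h1 h2.le) hv0 hv1
  set L := arcsOf Λ ax p (x :: y :: l) with hL
  have hnodup : (vertexSeq L).Nodup := by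
    rw [hL, vertexSeq_arcsOf]
    refine nodup_map_proj _ _ hsort fun s hs t ht hst => hper _ (sub_pos.2 hst) ?_
    linarith [((hmem s).1 hs).1.1, ((hmem t).1 ht).1.2]
  have hchain := isChain_arcsOf (Λ := Λ) ax p (x :: y :: l)
  have hedges : ∀ e ∈ L, e ∈ T.edges ∧ e.axis = ax := by
    intro e he
    obtain ⟨s, hs, t, ht, hst, hno, rfl⟩ := (mem_arcsOf ax p hsort).1 he
    have hs1 := (hmem s).1 hs
    have ht1 := (hmem t).1 ht
    have hshift : ∀ r : ℝ, p + s • ax.vec + r • ax.vec = p + (s + r) • ax.vec := fun r => by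
      rw [add_smul, add_assoc]
    have hno' : ∀ r ∈ Ioo s t, proj Λ (p + r • ax.vec) ∉ T.vertices := fun r hr hv =>
      hno r ((hmem r).2 ⟨⟨hs1.1.1.trans hr.1.le, hr.2.le.trans ht1.1.2⟩, hv⟩) hr
    obtain ⟨j, z, hz0, hz, hproj⟩ := (hside s ⟨hs1.1.1, hst.trans_le ht1.1.2⟩).exists_origin
      (r := t - s) fun r hr => by
        rw [hshift]
        exact hno' _ ⟨by linarith [hr.1], by linarith [hr.2]⟩
    simp only [hshift] at hproj
    have hzs := hproj 0
    have hzt := hproj (t - s)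
    rw [add_zero, add_zero] at hzs
    rw [add_sub_cancel] at hzt
    refine ⟨⟨j, _, (Rect.mem_sideStarts ax).2 ⟨by simp, Or.inl (by simp)⟩, z, z + (t - s), hz0,
      by linarith, hz, hzs.symm, by simp, hzs ▸ hs1.2, hzt ▸ ht1.2, fun r hr => ?_⟩, rfl⟩
    have := hno' (s + (r - z)) ⟨by linarith [hr.1], by linarith [hr.2]⟩
    rwa [← hproj, add_sub_cancel] at this
  have hedges' : ∀ e ∈ T.edges, e.axis = ax → e ∈ L := by
    rintro e he rfl
    obtain ⟨i, s, t, h0, hst, ht, hvs, hvt, hno, heq⟩ := T.exists_near_side hΛ he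
    obtain ⟨m, hm, hlo, h1, h2⟩ := hall i
    set z := (T.rect i).lo e.axis + e.axis.crd m - e.axis.crd p with hz
    have hproj : ∀ r : ℝ, proj Λ ((T.rect i).origin + r • e.axis.vec) =
        proj Λ (p + (z + r) • e.axis.vec) := by
      intro r
      have : p + (z + r) • e.axis.vec = (T.rect i).origin + r • e.axis.vec + m := by
        refine Axis.ext_crd e.axis ?_ ?_
        · simp only [Axis.crd_add, Axis.crd_vec, Rect.crd_origin, hz]
          ring
        · simp only [Axis.crd_add, Axis.crd_flip_vec, Rect.crd_origin]
          linarith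
      rw [this, proj_eq_proj]
      simpa using hm
    simp only [hproj] at hvs hvt hno heq
    rw [Rect.extent_eq] at ht
    refine (mem_arcsOf e.axis p hsort).2 ⟨z + s, (hmem _).2 ⟨⟨?_, ?_⟩, hvs⟩, z + t,
      (hmem _).2 ⟨⟨?_, ?_⟩, hvt⟩, by linarith, fun r hr hr' => ?_, ?_⟩
    any_goals linarith
    · refine hno (r - z) ⟨by linarith [hr'.1], by linarith [hr'.2]⟩ ?_
      rw [add_sub_cancel]
      exact ((hmem r).1 hr).2
    · rw [add_sub_add_left_eq_sub]
      exact heq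
  have hpath : T.IsAxisPath ax L :=
    ⟨by simp [hL, arcsOf], fun e he => (hedges e he).1, fun e he => (hedges e he).2, hchain, hnodup⟩
  have hinfix : ∀ Q, T.IsAxisPath ax Q → Q <:+: L := fun Q hQ =>
    isInfix_of_isChain hchain hnodup hQ.chain fun e he =>
      hedges' e (hQ.mem_edges e he) (hQ.axis_eq e he)
  refine ⟨L, ⟨hpath, fun Q hQ hLQ => ?_⟩, fun Q hQ => ?_⟩
  · exact (hinfix Q hQ).eq_of_length_le hLQ.length_le
  · exact (hQ.2 L hpath (hinfix Q hQ.1)).symm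

end Tiling

end FlatTorus

end

theorem lemma4p3 (u v : ℝ × ℝ) (huv : LinearIndependent ℝ ![u, v])
    (T : FlatTorus.Tiling (FlatTorus.latticeOf u v))
    (hT : (T.length : EReal) <
      min (FlatTorus.mAxis u v FlatTorus.Axis.hor) (FlatTorus.mAxis u v FlatTorus.Axis.ver)) :
    ∃ T' : FlatTorus.Tiling (FlatTorus.latticeOf u v),
      T'.length ≤ T.length ∧
      (∃! P, T'.IsMaximalAxisPath FlatTorus.Axis.hor P) ∧
      (∃! P, T'.IsMaximalAxisPath FlatTorus.Axis.ver P) := by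
  have hΛ := FlatTorus.locallyFinite_latticeOf huv
  -- among the tilings that are not longer than `T`, one with the least number of tiles
  obtain ⟨T', hT', hmin⟩ := (measure fun T' : FlatTorus.Tiling (FlatTorus.latticeOf u v) =>
    T'.k).wf.has_min {T' | T'.halfPerimeter ≤ T.halfPerimeter} ⟨T, le_refl T.halfPerimeter⟩
  have hred : T'.Reduced := fun S hS => not_lt.1 (hmin S (le_trans hS hT'))
  have hle : T'.length ≤ T.length := by
    rw [T'.length_eq_halfPerimeter hΛ, T.length_eq_halfPerimeter hΛ]
    exact hT'
  have hshort : ∀ ax, T'.Short ax := by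
    intro ax
    refine FlatTorus.short_of_lt_mAxis huv T' ax ?_
    rw [← T'.halfPerimeter_eq ax, ← T'.length_eq_halfPerimeter hΛ]
    refine (EReal.coe_le_coe_iff.2 hle).trans_lt (hT.trans_le ?_)
    cases ax
    exacts [min_le_left _ _, min_le_right _ _]
  exact ⟨T', hle, FlatTorus.Tiling.existsUnique_isMaximalAxisPath hΛ hred (hshort _) (hshort _),
    FlatTorus.Tiling.existsUnique_isMaximalAxisPath hΛ hred (hshort _) (hshort _)⟩
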